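/- Let $G=\langle a,b,c,d\rangle$ be the first Grigorchuk group, acting from the right on $\{0,1\}^\infty$ by $(0w)\cdot a=1w$, $(1w)\cdot a=0w$, $(0w)\cdot b=0(w\cdot a)$, $(1w)\cdot b=1(w\cdot c)$, $(0w)\cdot c=0(w\cdot a)$, $(1w)\cdot c=1(w\cdot d)$, $(0w)\cdot d=0w$, $(1w)\cdot d=1(w\cdot b)$. Put $S=\{a,b,c,d\}$ and let $\gamma_G(R)$ be the number of elements of $G$ that are products of at most $R$ elements of $S$. Write $f\preceq g$ if there is $C\ge 1$ with $f(R)\le g(CR)$ for all $R\ge 1$. Let $\xi=1^\infty$ and let $G_{(\xi)}$ be the group of the elements of $G$ that act trivially in a neighbourhood of $\xi$. The graph of germs $\widetilde\Gamma$ of $\xi$ has the right cosets $G_{(\xi)}g$ as vertices and an arrow labelled $s$ from $G_{(\xi)}g$ to $G_{(\xi)}gs$ for each $s\in S$. Define segments (chains with labelled edges) by $I_1=(\bullet\overset{a}{-}\bullet)$ and $I_{n+1}=I_n^{-1}e_nI_n$, where $e_n$ is a double edge with labels $c,d$ if $n\equiv 0$, $b,c$ if $n\equiv 1$, and $b,d$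 if $n\equiv 2$ modulo $3$. For $h\in\{1,b,c,d\}$, the graph $\widetilde\Gamma$ contains a copy of $I_m$ starting at $G_{(\xi)}h$, namely the path from $G_{(\xi)}h$ along the labels of $I_m$. For $n\ge 2$ let $\widetilde I_n\subset\widetilde\Gamma$ be the union of these four copies of $I_{n-1}$, and let $v_{n,h}$ be the final vertex of the copy starting at $G_{(\xi)}h$; the four vertices $v_{n,1},v_{n,b},v_{n,c},v_{n,d}$ are the boundary points of $\widetilde I_n$. For a word $w=s_1\cdots s_\ell\in S^*$ and $h\in\{b,c,d\}$, let $\widetilde T_{n,h}(w)$ be the number of subintervals $[i,j]\subseteq[1,\ell]$ with $v_{n,1}\cdot s_i\cdots s_j=v_{n,h}$ such that $v_{n,1}\cdot s_i\cdots s_k$ is a vertex of $\widetilde I_n$ other than the boundary points for all $i\le k<j$ (traverses of $\widetilde I_n$ from the branch $1$ to the branch $h$). Put $$F_w(t)=\sum_{n\ge 2}\bigl(\widetilde T_{n,b}(w)+\widetilde T_{n,c}(w)+\widetilde T_{n,d}(w)\bigr)t^n .$$ Then $x^3+x^2+x-2$ has exactly one positive root $\eta$, $\eta\approx 0.81054$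 (with an error less than $5\cdot 10^{-6}$), and the following hold. 1. For every $w\in S^*$ only finitely many terms of $F_w$ are non-zero, and there is a real Laurent polynomial $C(t)$ of the form $t^{-3}P(t)$ with $P\in\mathbb R[t]$, not depending on $w$, such that for all $w\in S^*$ and all $0<t<1/\eta$ the number $t^{-1}+t^{-2}+t^{-3}-2$ is positive and $$F_w(t)\le |w|\cdot\frac{C(t)}{t^{-1}+t^{-2}+t^{-3}-2}.$$ 2. For every $\alpha>\frac{\log 2}{\log 2-\log\eta}\approx 0.76743$ (with an error less than $5\cdot 10^{-6}$), one has $\gamma_G(R)\preceq\exp(R^\alpha)$. -/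

import Mathlib

/-! ### Growth of a group -/

/-- `ballCard S R` is the number of elements of `G` that are products of at most `R` elements
of `S` (for a symmetric generating set `S`, the growth function of `G`). -/
noncomputable def ballCard {G : Type*} [Group G] (S : Set G) (R : ℝ) : ℕ :=
  {g : G | ∃ l : List G, (∀ s ∈ l, s ∈ S) ∧ (l.length : ℝ) ≤ R ∧ l.prod = g}.ncard

/-- The comparison `f ⪯ g` of growth functions: `f R ≤ g (C R)` for some `C ≥ 1` and all
`R ≥ 1`. -/
def GrowthLE (f g : ℝ → ℝ) : Prop :=
  ∃ C : ℝ, 1 ≤ C ∧ ∀ R : ℝ, 1 ≤ R → f R ≤ g (C * R)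

namespace Grigorchuk

/-! ### The first Grigorchuk group -/

/-- The Cantor set `{0,1}^∞` (`false` is the letter `0` and `true` is the letter `1`), with the
product topology. -/
abbrev Cantor : Type := ℕ → Bool

/-- The four generators of the Grigorchuk group. -/
inductive Gen : Type
  | a | b | c | d
  deriving DecidableEq

/-- `coord k s x` is the `k`-th letter of `x · s`, where
`(0w)·a = 1w`, `(1w)·a = 0w`, `(0w)·b = 0(w·a)`, `(1w)·b = 1(w·c)`,
`(0w)·c = 0(w·a)`, `(1w)·c = 1(w·d)`, `(0w)·d = 0w`, `(1w)·d = 1(w·b)`. -/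
def coord : ℕ → Gen → Cantor → Bool
  | 0, .a, x => !(x 0)
  | 0, .b, x => x 0
  | 0, .c, x => x 0
  | 0, .d, x => x 0
  | k + 1, .a, x => x (k + 1)
  | k + 1, .b, x =>
      if x 0 then coord k .c (fun i => x (i + 1)) else coord k .a (fun i => x (i + 1))
  | k + 1, .c, x =>
      if x 0 then coord k .d (fun i => x (i + 1)) else coord k .a (fun i => x (i + 1))
  | k + 1, .d, x =>
      if x 0 then coord k .b (fun i => x (i + 1)) else x (k + 1)

/-- The transformation `x ↦ x · s` of the Cantor set. -/
def act (s : Gen) (x : Cantor) : Cantor := fun k => coord k s x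

theorem coord_act (k : ℕ) : ∀ (s : Gen) (x : Cantor), coord k s (act s x) = x k := by
  induction k with
  | zero => intro s x; cases s <;> simp [act, coord]
  | succ k ih =>
    intro s x
    have e : ∀ s t : Gen, (∀ i, coord (i + 1) s x = coord i t (fun i => x (i + 1))) →
        (fun i => act s x (i + 1)) = act t (fun i => x (i + 1)) := by
      intro s t h
      funext i
      exact h i
    cases s
    · simp [act, coord]
    · have h0 : act .b x 0 = x 0 := rfl
      rw [coord, h0]
      cases h : x 0
      · rw [e .b .a (fun i => by simp [coord, h])]; simp [ih]
      · rw [e .b .c (fun i => by simp [coord, h])]; simp [ih]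
    · have h0 : act .c x 0 = x 0 := rfl
      rw [coord, h0]
      cases h : x 0
      · rw [e .c .a (fun i => by simp [coord, h])]; simp [ih]
      · rw [e .c .d (fun i => by simp [coord, h])]; simp [ih]
    · have h0 : act .d x 0 = x 0 := rfl
      rw [coord, h0]
      cases h : x 0
      · simp [act, coord, h]
      · rw [e .d .b (fun i => by simp [coord, h])]; simp [ih]

theorem act_involutive (s : Gen) : Function.Involutive (act s) :=
  fun x => funext fun k => coord_act k s x

/-- The generators as permutations of the Cantor set. In `(Equiv.Perm Cantor)ᵐᵒᵖ` a product
`g * h` is "first `g`, then `h`", so that permutations act from the right. -/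
def genPerm (s : Gen) : (Equiv.Perm Cantor)ᵐᵒᵖ :=
  MulOpposite.op ((act_involutive s).toPerm (act s))

/-- The first Grigorchuk group `G = ⟨a, b, c, d⟩`, acting on the Cantor set from the right. -/
def grig : Subgroup (Equiv.Perm Cantor)ᵐᵒᵖ := Subgroup.closure (Set.range genPerm)

/-- The generators as elements of the Grigorchuk group. -/
def gen (s : Gen) : grig := ⟨genPerm s, Subgroup.subset_closure ⟨s, rfl⟩⟩

/-- The point `x · g`. -/
def rightAct (x : Cantor) (g : grig) : Cantor := g.1.unop x

theorem rightAct_one (x : Cantor) : rightAct x 1 = x := rfl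

theorem rightAct_mul (x : Cantor) (g h : grig) :
    rightAct x (g * h) = rightAct (rightAct x g) h := rfl

theorem rightAct_gen (x : Cantor) (s : Gen) : rightAct x (gen s) = act s x := rfl

/-- The element of `G` represented by a word `s₁s₂⋯s_ℓ`. -/
def eval (w : List Gen) : grig := (w.map gen).prod

/-- The growth function of the Grigorchuk group with respect to `{a, b, c, d}`. -/
noncomputable def growth (R : ℝ) : ℕ := ballCard (Set.range gen) R

/-! ### The graph of germs of `1^∞` -/

/-- The singular point `1^∞`. -/
def ones : Cantor := fun _ => true

/-- The group `G_(ξ)` of elements acting trivially in a neighbourhood of `ξ`. -/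
def germStab (ξ : Cantor) : Subgroup grig where
  carrier := {g | ∀ᶠ x in nhds ξ, rightAct x g = x}
  one_mem' := Filter.Eventually.of_forall rightAct_one
  mul_mem' := by
    intro g h hg hh
    filter_upwards [hg, hh] with x hx hx'
    rw [rightAct_mul, hx, hx']
  inv_mem' := by
    intro g hg
    filter_upwards [hg] with x hx
    have h : rightAct (rightAct x g) g⁻¹ = x := by
      rw [← rightAct_mul, mul_inv_cancel, rightAct_one]
    rwa [hx] at h

/-- The vertices of the graph of germs of `1^∞`: the right cosets `G_(ξ) g`, `ξ = 1^∞`. -/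
abbrev GermVertex : Type := Quotient (QuotientGroup.rightRel (germStab ones))

/-- The vertex `G_(ξ) g`. -/
def vertex (g : grig) : GermVertex := Quotient.mk _ g

/-- The action of `G` on the vertices of the graph of germs, `G_(ξ) g · h = G_(ξ) gh`. In the
graph of germs there is an arrow labelled `s` from `v` to `v.move (gen s)`. -/
def GermVertex.move (v : GermVertex) (h : grig) : GermVertex :=
  Quotient.map' (· * h) (by
    intro g g' hg
    rw [QuotientGroup.rightRel_apply] at hg ⊢
    simpa [mul_assoc] using hg) v

/-! ### Segments, their copies in the graph of germs, and traverses -/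

/-- One of the two labels of the double edge `e_n`, where `e_n` is labelled by `c, d` if
`n ≡ 0`, by `b, c` if `n ≡ 1`, and by `b, d` if `n ≡ 2` modulo `3`. -/
def edgeLabel (n : ℕ) : Gen :=
  if n % 3 = 0 then .c else if n % 3 = 1 then .b else .d

/-- Labels read along the segment `I_n` from its initial to its final vertex, where
`I_1 = 0 -a- 1` and `I_{n+1} = I_n⁻¹ e_n I_n` (and `I_0` is a single vertex). Where there is a
double edge one of its two labels is read; both lead to the same vertex. -/
def segment : ℕ → List Gen
  | 0 => []
  | 1 => [.a]
  | n + 2 => (segment (n + 1)).reverse ++ edgeLabel (n + 1) :: segment (n + 1)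

/-- The vertices of the copy of `I_m` labelled `h` in the graph of germs: it starts at the origin
`G_(ξ) h` of the branch labelled `h`. -/
def branch (h : grig) (m : ℕ) : Set GermVertex :=
  {v | ∃ u : List Gen, u <+: segment m ∧ v = vertex (h * eval u)}

/-- The final vertex of the copy of `I_m` labelled `h`. -/
def tip (h : grig) (m : ℕ) : GermVertex := vertex (h * eval (segment m))

/-- The labels `1, b, c, d` of the four branches of the graph of germs. -/
def branchLabels : Set grig := {1, gen .b, gen .c, gen .d}

/-- The vertices of the central part `Ĩ_n` (`n ≥ 2`) of the graph of germs: four copies of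
`I_{n-1}`, whose origins `1, b, c, d` are connected with each other. -/
def tile (n : ℕ) : Set GermVertex := ⋃ h ∈ branchLabels, branch h (n - 1)

/-- The four boundary points of `Ĩ_n`. -/
def tileBoundary (n : ℕ) : Set GermVertex := (fun h => tip h (n - 1)) '' branchLabels

/-- The traverses of `Ĩ_n`, for the word `w = s₁⋯s_ℓ`, from the boundary point in the branch
labelled `1` to the one in the branch labelled `h`. The pair `(i, j)` stands for the subinterval
`[i+1, j]` of `[1, ℓ]`: the path `v₀, v₀·s_{i+1}, …, v₀·s_{i+1}⋯s_j` stays inside `Ĩ_n`, its last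
vertex is the exit, and the vertices strictly in between are not boundary points. -/
def traverses (n : ℕ) (h : grig) (w : List Gen) : Set (ℕ × ℕ) :=
  {p | p.1 < p.2 ∧ p.2 ≤ w.length ∧
    (tip 1 (n - 1)).move (eval ((w.take p.2).drop p.1)) = tip h (n - 1) ∧
    ∀ k, p.1 < k → k < p.2 →
      (tip 1 (n - 1)).move (eval ((w.take k).drop p.1)) ∈ tile n \ tileBoundary n}

/-- The number of traverses of `Ĩ_n` for `w` that exit in one of the branches `b, c, d`. -/
noncomputable def traverseCount (n : ℕ) (w : List Gen) : ℕ :=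
  ∑ s ∈ ({.b, .c, .d} : Finset Gen), (traverses n (gen s) w).ncard

/-- The generating function `F(t)` of the number of traverses of `Ĩ_n`, `n ≥ 2`. -/
noncomputable def traverseSeries (w : List Gen) (t : ℝ) : ℝ :=
  ∑' n : ℕ, (traverseCount (n + 2) w : ℝ) * t ^ (n + 2)

end Grigorchuk

namespace Grigorchuk

/-! ### Words with trivial letters and their sections -/

/-! Both bounds rest on one contraction. Each generator acts on the tail of a point through a
section depending on the first letter. With weights adapted to the root `η`, a pair consisting of a
letter `b`, `c` or `d` and an `a` has sections at `0` and `1` of total weight `η` times its own.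
Merging adjacent letters `b, c, d` brings every word into a form built from such pairs, so the
sections of the merged word weigh together at most `η` times the word (`weight_merge_sections`).

Traverses: a germ at `1^∞` is a first letter together with the germ of the section at `1`
(`vertex_wordElt_eq_iff`), and this section maps `Ĩ_{n+1}` to `Ĩ_n`. A traverse of `Ĩ_{n+1}` thus
becomes a path in `Ĩ_n`, driven by one of the two sections of the word, and this path contains a
traverse. The assignment is injective on start times for each section (`ncard_starts_succ_le`), and
merging loses no traverse (`starts_append_merge`). As every traverse starts with an `a`, induction
gives at most `|w| η^k / (1 - η^3)` traverses of `Ĩ_{k+2}`. Summing the geometric series yields the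
bound on `F_w`, because `1 - η t` divides `1 + t + t^2 - 2 t^3`.

Growth: an element is determined, up to boundedly many choices, by its two sections, so balls of
weighted radius `R` are bounded by products of balls whose radii add up to `η R + 1`
(`ncard_ball_le`). This recursion is compatible with `exp (C (R + 1)^α)` as soon as `2 (η / 2)^α <
1`, which is the stated lower bound on `α`.

Trivial letters keep all words at the same length, so that a word, its merged form and its sections
share one time axis. -/

/-- The Cantor point `x y`, with first letter `x`. -/
def cons (x : Bool) (y : Cantor) : Cantor
  | 0 => x
  | k + 1 => y k

theorem cons_head_tail (x : Cantor) : cons (x 0) (fun k => x (k + 1)) = x := by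
  funext k; cases k <;> rfl

theorem cons_inj {x x' : Bool} {y y' : Cantor} : cons x y = cons x' y' ↔ x = x' ∧ y = y' := by
  constructor
  · intro h
    exact ⟨congrFun h 0, funext fun k => congrFun h (k + 1)⟩
  · rintro ⟨rfl, rfl⟩; rfl

/-- A letter is a generator or the trivial letter `none`. -/
abbrev Letter : Type := Option Gen

/-- Whether a letter changes the first coordinate. -/
def flips : Letter → Bool
  | some .a => true
  | _ => false

/-- The section of a letter at a first coordinate. -/
def letterSection : Bool → Letter → Letter
  | true, some .b => some .c
  | true, some .c => some .d
  | true, some .d => some .b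
  | false, some .b => some .a
  | false, some .c => some .a
  | _, _ => none

/-- The group element of a letter. -/
def letterElt : Letter → grig
  | none => 1
  | some s => gen s

/-- The group element of a word. -/
def wordElt (w : List Letter) : grig := (w.map letterElt).prod

theorem letterElt_none : letterElt none = 1 := rfl

/-- Whether a word changes the first coordinate. -/
def parity : List Letter → Bool
  | [] => false
  | l :: w => xor (flips l) (parity w)

/-- The section of a word at a first coordinate, as a word of the same length. -/
def sectionWord : Bool → List Letter → List Letter
  | _, [] => []
  | x, l :: w => letterSection x l :: sectionWord (xor x (flips l)) w

@[simp] theorem wordElt_nil : wordElt [] = 1 := rfl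

@[simp] theorem wordElt_cons (l : Letter) (w : List Letter) :
    wordElt (l :: w) = letterElt l * wordElt w := by simp [wordElt]

@[simp] theorem wordElt_append (u w : List Letter) :
    wordElt (u ++ w) = wordElt u * wordElt w := by simp [wordElt]

theorem eval_eq_wordElt (w : List Gen) : eval w = wordElt (w.map some) := by
  simp only [eval, wordElt, List.map_map]
  rfl

theorem wordElt_reduceOption (w : List Letter) : eval w.reduceOption = wordElt w := by
  induction w with
  | nil => rfl
  | cons l w ih =>
    cases l with
    | none => simpa [letterElt] using ih
    | some s => simp [letterElt, ← ih, eval]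

theorem sectionWord_nil (x : Bool) : sectionWord x [] = [] := rfl

theorem parity_append (u w : List Letter) : parity (u ++ w) = xor (parity u) (parity w) := by
  induction u with
  | nil => simp [parity]
  | cons l u ih => simp [parity, ih]

theorem sectionWord_append (x : Bool) (u w : List Letter) :
    sectionWord x (u ++ w) = sectionWord x u ++ sectionWord (xor x (parity u)) w := by
  induction u generalizing x with
  | nil => simp [sectionWord, parity]
  | cons l u ih => simp [sectionWord, parity, ih]

@[simp] theorem sectionWord_length (x : Bool) (w : List Letter) :
    (sectionWord x w).length = w.length := by
  induction w generalizing x with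
  | nil => rfl
  | cons l w ih => simp [sectionWord, ih]

theorem sectionWord_take (x : Bool) (w : List Letter) (k : ℕ) :
    sectionWord x (w.take k) = (sectionWord x w).take k := by
  induction w generalizing x k with
  | nil => simp [sectionWord]
  | cons l w ih => cases k <;> simp [sectionWord, ih]

theorem sectionWord_drop (x : Bool) (w : List Letter) (k : ℕ) :
    sectionWord (xor x (parity (w.take k))) (w.drop k) = (sectionWord x w).drop k := by
  induction w generalizing x k with
  | nil => simp [sectionWord]
  | cons l w ih =>
    cases k with
    | zero => simp [sectionWord, parity]
    | succ k => simpa [sectionWord, parity] using ih (xor x (flips l)) k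

theorem act_cons_a (x : Bool) (y : Cantor) : act .a (cons x y) = cons (!x) y := by
  funext k; cases k <;> rfl

theorem act_cons_b (x : Bool) (y : Cantor) :
    act .b (cons x y) = cons x (if x then act .c y else act .a y) := by
  funext k
  cases k
  · rfl
  · cases x <;> rfl

theorem act_cons_c (x : Bool) (y : Cantor) :
    act .c (cons x y) = cons x (if x then act .d y else act .a y) := by
  funext k
  cases k
  · rfl
  · cases x <;> rfl

theorem act_cons_d (x : Bool) (y : Cantor) :
    act .d (cons x y) = cons x (if x then act .b y else y) := by
  funext k
  cases k
  · rfl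
  · cases x <;> rfl

theorem rightAct_cons_letterElt (x : Bool) (y : Cantor) (l : Letter) :
    rightAct (cons x y) (letterElt l) =
      cons (xor x (flips l)) (rightAct y (letterElt (letterSection x l))) := by
  rcases l with _ | _ | _ | _ | _ <;> cases x <;>
    simp [letterElt, letterSection, flips, rightAct_gen, rightAct_one, act_cons_a, act_cons_b,
      act_cons_c, act_cons_d]

theorem rightAct_cons_wordElt (x : Bool) (y : Cantor) (w : List Letter) :
    rightAct (cons x y) (wordElt w) =
      cons (xor x (parity w)) (rightAct y (wordElt (sectionWord x w))) := by
  induction w generalizing x y with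
  | nil => simp [parity, sectionWord, rightAct_one]
  | cons l w ih =>
    simp [rightAct_mul, rightAct_cons_letterElt, ih, parity, sectionWord]

theorem grig_ext {g h : grig} (H : ∀ x, rightAct x g = rightAct x h) : g = h :=
  Subtype.ext (MulOpposite.unop_injective (Equiv.ext H))

theorem wordElt_eq_of_sections {u w : List Letter} (h : parity u = parity w)
    (hs : ∀ x, wordElt (sectionWord x u) = wordElt (sectionWord x w)) :
    wordElt u = wordElt w := by
  refine grig_ext fun x => ?_
  rw [← cons_head_tail x, rightAct_cons_wordElt, rightAct_cons_wordElt, h, hs]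

theorem letterElt_mul_self (l : Letter) : letterElt l * letterElt l = 1 := by
  refine grig_ext fun x => ?_
  cases l with
  | none => rfl
  | some s => exact act_involutive s x

/-! ### Merging runs of letters `b, c, d` -/

/-- The product in the four-group `{1, b, c, d}`. -/
def fourMul : Letter → Letter → Letter
  | none, y => y
  | x, none => x
  | some .b, some .c => some .d
  | some .c, some .b => some .d
  | some .b, some .d => some .c
  | some .d, some .b => some .c
  | some .c, some .d => some .b
  | some .d, some .c => some .b
  | _, _ => none

theorem fourMul_ne {x y : Letter} (hx : x ≠ some .a) (hy : y ≠ some .a) :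
    fourMul x y ≠ some .a := by
  rcases x with _ | _ | _ | _ | _ <;> rcases y with _ | _ | _ | _ | _ <;>
    simp_all [fourMul]

/-- Passing to the section at `1` permutes the three relations cyclically, so they are proved
together by induction on the coordinate. At `0` only `a` and the identity occur, and `a` is an
involution. -/
theorem act_four (x : Cantor) : act .c (act .b x) = act .d x ∧ act .d (act .c x) = act .b x ∧
    act .b (act .d x) = act .c x := by
  have key : ∀ k, ∀ x : Cantor, act .c (act .b x) k = act .d x k ∧
      act .d (act .c x) k = act .b x k ∧ act .b (act .d x) k = act .c x k := by
    intro k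
    induction k with
    | zero => intro x; exact ⟨rfl, rfl, rfl⟩
    | succ k ih =>
      intro x
      rw [← cons_head_tail x]
      set y : Cantor := fun k => x (k + 1)
      obtain ⟨h1, h2, h3⟩ := ih y
      cases x 0
      · simp [act_cons_b, act_cons_c, act_cons_d, act_involutive .a y]
      · simp only [act_cons_b, act_cons_c, act_cons_d, if_true]
        exact ⟨h2, h3, h1⟩
  exact ⟨funext fun k => (key k x).1, funext fun k => (key k x).2.1,
    funext fun k => (key k x).2.2⟩

theorem letterElt_fourMul {x y : Letter} (hx : x ≠ some .a) (hy : y ≠ some .a) :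
    letterElt (fourMul x y) = letterElt x * letterElt y := by
  have e : ∀ s, gen s * gen s = 1 := fun s => letterElt_mul_self (some s)
  have h1 : gen .b * gen .c = gen .d := grig_ext fun x => (act_four x).1
  have h2 : gen .c * gen .d = gen .b := grig_ext fun x => (act_four x).2.1
  have h3 : gen .d * gen .b = gen .c := grig_ext fun x => (act_four x).2.2
  have h4 : gen .c * gen .b = gen .d := by rw [← h2, ← mul_assoc, e, one_mul]
  have h5 : gen .d * gen .c = gen .b := by rw [← h3, ← mul_assoc, e, one_mul]
  have h6 : gen .b * gen .d = gen .c := by rw [← h1, ← mul_assoc, e, one_mul]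
  rcases x with _ | _ | _ | _ | _ <;> rcases y with _ | _ | _ | _ | _ <;>
    simp_all [fourMul, letterElt]

/-- Merge every run of letters `b, c, d` into a single letter at its end, and erase the last
run of the word. The length of the word does not change. -/
def merge : List Letter → List Letter
  | [] => []
  | some .a :: l => some .a :: merge l
  | [_] => [none]
  | x :: some .a :: l => x :: some .a :: merge l
  | x :: y :: l => none :: merge (fourMul x y :: l)
termination_by l => l.length

/-- Induction along the recursion of `merge`. -/
theorem merge_induction {p : List Letter → Prop} (nil : p [])
    (cons_a : ∀ l, p l → p (some .a :: l)) (single : ∀ x, x ≠ some .a → p [x])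
    (cons_cons_a : ∀ x l, x ≠ some .a → p l → p (x :: some .a :: l))
    (cons_cons : ∀ x y l, x ≠ some .a → y ≠ some .a → p (fourMul x y :: l) → p (x :: y :: l)) :
    ∀ l, p l := by
  intro l
  induction hn : l.length using Nat.strong_induction_on generalizing l with
  | _ n ih =>
    subst hn
    match l with
    | [] => exact nil
    | [x] =>
      by_cases hx : x = some .a
      · subst hx; exact cons_a _ nil
      · exact single x hx
    | x :: y :: l =>
      by_cases hx : x = some .a
      · subst hx; exact cons_a _ (ih _ (by simp) _ rfl)
      · by_cases hy : y = some .a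
        · subst hy; exact cons_cons_a x l hx (ih _ (by simp) _ rfl)
        · exact cons_cons x y l hx hy (ih _ (by simp) _ rfl)

theorem merge_nil : merge [] = [] := by rw [merge]

theorem merge_a (l : List Letter) : merge (some .a :: l) = some .a :: merge l := by rw [merge]

theorem merge_single {x : Letter} (hx : x ≠ some .a) : merge [x] = [none] := by
  rw [merge]; simpa using hx

theorem merge_cons_a {x : Letter} (hx : x ≠ some .a) (l : List Letter) :
    merge (x :: some .a :: l) = x :: some .a :: merge l := by
  rw [merge]; simpa using hx

theorem merge_cons_cons {x y : Letter} (hx : x ≠ some .a) (hy : y ≠ some .a) (l : List Letter) :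
    merge (x :: y :: l) = none :: merge (fourMul x y :: l) := by
  rw [merge]
  · simpa using hx
  · simpa using hy

/-- Only the erased last run is lost, and its product is a single letter. -/
theorem wordElt_merge (w : List Letter) :
    ∃ x : Letter, wordElt w = wordElt (merge w) * letterElt x := by
  induction w using merge_induction with
  | nil => exact ⟨none, by simp [merge_nil, letterElt]⟩
  | cons_a l ih =>
    obtain ⟨x, hx⟩ := ih
    exact ⟨x, by simp [merge_a, hx, mul_assoc]⟩
  | single x hx => exact ⟨x, by simp [merge_single hx, letterElt]⟩
  | cons_cons_a x l hx ih =>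
    obtain ⟨y, hy⟩ := ih
    exact ⟨y, by simp [merge_cons_a hx, hy, mul_assoc]⟩
  | cons_cons x y l hx hy ih =>
    obtain ⟨z, hz⟩ := ih
    refine ⟨z, ?_⟩
    rw [merge_cons_cons hx hy, wordElt_cons none, mul_assoc, ← hz]
    simp only [wordElt_cons, letterElt_fourMul hx hy, mul_assoc, show letterElt none = 1 from rfl,
      one_mul]

/-! ### The weighted length -/

/-- The weights of the letters. -/
def letterWeight (η : ℝ) : Letter → ℝ
  | none => 0
  | some .a => 1 - η ^ 3
  | some .b => η ^ 3
  | some .c => 1 - η ^ 2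
  | some .d => 1 - η

/-- The weight of a word. -/
def weight (η : ℝ) (w : List Letter) : ℝ := (w.map (letterWeight η)).sum

@[simp] theorem weight_nil (η : ℝ) : weight η [] = 0 := rfl

@[simp] theorem weight_cons (η : ℝ) (l : Letter) (w : List Letter) :
    weight η (l :: w) = letterWeight η l + weight η w := by simp [weight]

section Weight

variable {η : ℝ} (h0 : 0 < η) (hη : η ^ 3 + η ^ 2 + η - 2 = 0)
include h0 hη

theorem root_lt_one : η < 1 := by
  by_contra! h
  nlinarith [one_le_pow₀ h (n := 3), one_le_pow₀ h (n := 2)]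

theorem letterWeight_nonneg (l : Letter) : 0 ≤ letterWeight η l := by
  have h1 := (root_lt_one h0 hη).le
  rcases l with _ | _ | _ | _ | _ <;> simp only [letterWeight, sub_nonneg]
  · exact le_rfl
  · exact pow_le_one₀ h0.le h1
  · positivity
  · exact pow_le_one₀ h0.le h1
  · exact h1

theorem letterWeight_le_one (l : Letter) : letterWeight η l ≤ 1 := by
  have h1 := (root_lt_one h0 hη).le
  rcases l with _ | _ | _ | _ | _ <;> simp only [letterWeight]
  · exact zero_le_one
  · linarith [pow_pos h0 3]
  · exact pow_le_one₀ h0.le h1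
  · linarith [pow_pos h0 2]
  · linarith

theorem weight_nonneg (w : List Letter) : 0 ≤ weight η w := by
  induction w with
  | nil => simp
  | cons l w ih => rw [weight_cons]; linarith [letterWeight_nonneg h0 hη l]

theorem weight_le_length (w : List Letter) : weight η w ≤ w.length := by
  induction w with
  | nil => simp
  | cons l w ih =>
    rw [weight_cons, List.length_cons]; push_cast; linarith [letterWeight_le_one h0 hη l]

/-- By the equation of `η`, the weight of `b` is the sum of those of `c` and `d`; hence merging does
not increase weights. -/
theorem letterWeight_fourMul {x y : Letter} (hx : x ≠ some .a) (hy : y ≠ some .a) :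
    letterWeight η (fourMul x y) ≤ letterWeight η x + letterWeight η y := by
  have h1 := root_lt_one h0 hη
  have h2 : 0 < η ^ 2 := by positivity
  have h3 : 0 < η ^ 3 := by positivity
  have h4 : η ^ 2 < η := by nlinarith
  have h5 : η ^ 3 < η ^ 2 := by nlinarith
  rcases x with _ | _ | _ | _ | _ <;> rcases y with _ | _ | _ | _ | _ <;>
    first
    | exact absurd rfl hx
    | exact absurd rfl hy
    | (simp only [letterWeight, fourMul]; nlinarith)

/-- The weights are chosen to give equality for `b`, `c` and `d`: each difference is a multiple of
the cubic. -/
theorem letterWeight_section_le (l : Letter) (hl : l ≠ some .a) :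
    letterWeight η (letterSection false l) + letterWeight η (letterSection true l) ≤
      η * (letterWeight η (some .a) + letterWeight η l) := by
  have h3 : η ^ 3 < 1 := pow_lt_one₀ h0.le (root_lt_one h0 hη) (by norm_num)
  rcases l with _ | _ | _ | _ | _
  · simp only [letterWeight, letterSection]; nlinarith
  · exact absurd rfl hl
  · simp only [letterWeight, letterSection]; linear_combination (-1 : ℝ) * hη
  · simp only [letterWeight, letterSection]; linear_combination (η - 1) * hη
  · simp only [letterWeight, letterSection]; linear_combination η * hη

/-- In a merged word each surviving `b`, `c`, `d` is followed by an `a`, with which it is paired;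
this is why the last run is erased. Unpaired letters `a` have trivial sections. -/
theorem weight_merge_sections (w : List Letter) (x : Bool) :
    weight η (sectionWord x (merge w)) + weight η (sectionWord (!x) (merge w)) ≤
      η * weight η w := by
  have hs : ∀ (x : Bool) (l : Letter), l ≠ some .a →
      letterWeight η (letterSection x l) + letterWeight η (letterSection (!x) l) ≤
        η * (letterWeight η (some .a) + letterWeight η l) := by
    intro x l hl
    have := letterWeight_section_le h0 hη l hl
    cases x
    · exact this
    · rw [add_comm]; exact this
  have hfl : ∀ l : Letter, l ≠ some .a → flips l = false := by
    intro l hl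
    rcases l with _ | _ | _ | _ | _ <;> simp_all [flips]
  have hn : ∀ x, letterSection x none = none := by decide
  have ha : ∀ x, letterSection x (some .a) = none := by decide
  have hfa : flips (some .a) = true := rfl
  have hfn : flips none = false := rfl
  have hz : letterWeight η none = 0 := rfl
  have hpa := letterWeight_nonneg h0 hη (some .a)
  induction w using merge_induction generalizing x with
  | nil => simp [merge_nil, sectionWord]
  | cons_a l ih =>
    -- An `a` interchanges the roles of the two sections.
    have := ih (!x)
    simp only [merge_a, sectionWord, weight_cons, ha, hfa, hz, Bool.xor_true]
    nlinarith
  | single l hl =>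
    have := letterWeight_nonneg h0 hη l
    simp only [merge_single hl, sectionWord, weight_cons, weight_nil, hn, hz]
    nlinarith
  | cons_cons_a l w hl ih =>
    have := ih (!x)
    have := hs x l hl
    simp only [merge_cons_a hl, sectionWord, weight_cons, ha, hfa, hz, Bool.xor_true, hfl l hl,
      Bool.xor_false]
    nlinarith
  | cons_cons l m w hl hm ih =>
    have h1 := ih x
    have h2 := letterWeight_fourMul h0 hη hl hm
    simp only [merge_cons_cons hl hm, sectionWord, weight_cons, hn, hfn, hz, Bool.xor_false]
    simp only [weight_cons] at h1
    nlinarith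

end Weight

open Filter Topology

/-! ### Germs at `1^∞` -/

theorem cons_true_ones : cons true ones = ones := by
  funext k; cases k <;> rfl

theorem continuous_cons (x : Bool) : Continuous (cons x) := by
  refine continuous_pi fun k => ?_
  cases k
  · exact continuous_const
  · exact continuous_apply _

/-- Prefixing `1` is a homeomorphism onto a clopen neighbourhood of `1^∞` and fixes `1^∞`. -/
theorem eventually_ones_iff {p : Cantor → Prop} :
    (∀ᶠ x in 𝓝 ones, p x) ↔ ∀ᶠ y in 𝓝 ones, p (cons true y) := by
  constructor
  · intro h
    have hc := (continuous_cons true).tendsto ones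
    rw [cons_true_ones] at hc
    exact hc.eventually h
  · intro h
    have hc : Continuous fun (x : Cantor) (k : ℕ) => x (k + 1) :=
      continuous_pi fun k => continuous_apply _
    have h0 : Continuous fun x : Cantor => x 0 := continuous_apply 0
    have h1 : ∀ᶠ x : Cantor in 𝓝 ones, x 0 = true :=
      ((isOpen_discrete ({true} : Set Bool)).preimage h0).mem_nhds rfl
    filter_upwards [(hc.tendsto ones).eventually h, h1] with x hx hx0
    rwa [← hx0, cons_head_tail] at hx

theorem vertex_eq_iff {g h : grig} :
    vertex g = vertex h ↔ ∀ᶠ x in 𝓝 ones, rightAct x g = rightAct x h := by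
  rw [vertex, vertex, Quotient.eq, QuotientGroup.rightRel_apply]
  refine eventually_congr (Eventually.of_forall fun x => ?_)
  rw [rightAct_mul]
  constructor
  · intro e
    have := congrArg (rightAct · g) e
    rw [← rightAct_mul, inv_mul_cancel, rightAct_one] at this
    exact this.symm
  · intro e
    rw [← e, ← rightAct_mul, mul_inv_cancel, rightAct_one]

theorem vertex_mul_right {g h : grig} (k : grig) :
    vertex (g * k) = vertex (h * k) ↔ vertex g = vertex h := by
  rw [vertex_eq_iff, vertex_eq_iff]
  refine eventually_congr (Eventually.of_forall fun x => ?_)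
  rw [rightAct_mul, rightAct_mul]
  exact (k.1.unop).injective.eq_iff

theorem move_vertex (g h : grig) : (vertex g).move h = vertex (g * h) := rfl

/-- The germ of a word is determined by the first letter of the image of `1^∞` and by the germ
of the section at `1`. -/
theorem vertex_wordElt_eq_iff {u w : List Letter} :
    vertex (wordElt u) = vertex (wordElt w) ↔ parity u = parity w ∧
      vertex (wordElt (sectionWord true u)) = vertex (wordElt (sectionWord true w)) := by
  rw [vertex_eq_iff, vertex_eq_iff, eventually_ones_iff]
  simp only [rightAct_cons_wordElt, cons_inj, eventually_and]
  refine and_congr_left fun _ => ?_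
  rw [eventually_const]
  simp

/-! ### Segments -/

theorem segment_reverse (m : ℕ) : (segment m).reverse = segment m := by
  match m with
  | 0 => rfl
  | 1 => rfl
  | m + 2 => simp [segment]

theorem segment_succ (m : ℕ) :
    segment (m + 2) = segment (m + 1) ++ edgeLabel (m + 1) :: segment (m + 1) := by
  rw [segment, segment_reverse]

theorem edgeLabel_ne (m : ℕ) : edgeLabel m ≠ .a := by
  unfold edgeLabel; split_ifs <;> simp

theorem letterSection_edgeLabel (m : ℕ) :
    letterSection true (some (edgeLabel (m + 1))) = some (edgeLabel m) := by
  have : m % 3 < 3 := Nat.mod_lt _ (by norm_num)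
  unfold edgeLabel
  rw [Nat.add_mod]
  interval_cases m % 3 <;> rfl

theorem flips_of_ne {x : Letter} (hx : x ≠ some .a) : flips x = false := by
  rcases x with _ | _ | _ | _ | _ <;> simp_all [flips]

theorem letterSection_true_ne (x : Letter) : letterSection true x ≠ some .a := by
  rcases x with _ | _ | _ | _ | _ <;> simp [letterSection]

theorem parity_segment (m : ℕ) : parity ((segment (m + 2)).map some) = false := by
  have : flips (some (edgeLabel (m + 1))) = false :=
    flips_of_ne (by simpa using edgeLabel_ne _)
  simp [segment_succ, parity_append, parity, this]

/-- Longer segments have even parity, so the middle edge is read at first letter `1`, where taking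
sections lowers the index of the edge label by one. The base case is `aba`, whose section is `a`. -/
theorem sectionWord_segment (m : ℕ) :
    (sectionWord true ((segment (m + 2)).map some)).reduceOption = segment (m + 1) := by
  induction m with
  | zero => decide
  | succ m ih =>
    have : flips (some (edgeLabel (m + 2))) = false :=
      flips_of_ne (by simpa using edgeLabel_ne _)
    rw [segment_succ]
    simp only [List.map_append, List.map_cons, sectionWord_append, sectionWord, this,
      parity_segment, Bool.xor_false, letterSection_edgeLabel, List.reduceOption_append,
      List.reduceOption_cons_of_some, ih]
    rw [← segment_succ]

theorem wordElt_sectionWord_segment (m : ℕ) :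
    wordElt (sectionWord true ((segment (m + 2)).map some)) =
      wordElt ((segment (m + 1)).map some) := by
  rw [← wordElt_reduceOption, sectionWord_segment, eval_eq_wordElt]

/-! ### Tips and tiles in terms of words -/

theorem branchLabels_eq : branchLabels = letterElt '' {x | x ≠ some .a} := by
  ext g
  simp only [branchLabels, Set.mem_insert_iff, Set.mem_singleton_iff, Set.mem_image,
    Set.mem_ofPred_eq]
  constructor
  · rintro (rfl | rfl | rfl | rfl)
    · exact ⟨none, by simp, rfl⟩
    · exact ⟨some .b, by simp, rfl⟩
    · exact ⟨some .c, by simp, rfl⟩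
    · exact ⟨some .d, by simp, rfl⟩
  · rintro ⟨x, hx, rfl⟩
    rcases x with _ | _ | _ | _ | _ <;> simp_all [letterElt]

theorem tip_letterElt (x : Letter) (m : ℕ) :
    tip (letterElt x) m = vertex (wordElt (x :: (segment m).map some)) := by
  rw [tip, eval_eq_wordElt, wordElt_cons]

theorem mem_tile_iff {n : ℕ} {v : GermVertex} :
    v ∈ tile n ↔ ∃ x : Letter, x ≠ some .a ∧ ∃ p : List Gen, p <+: segment (n - 1) ∧
      v = vertex (wordElt (x :: p.map some)) := by
  simp only [tile, branchLabels_eq, Set.mem_iUnion, Set.mem_image, Set.mem_ofPred_eq, branch]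
  constructor
  · rintro ⟨g, ⟨x, hx, rfl⟩, p, hp, rfl⟩
    exact ⟨x, hx, p, hp, by rw [eval_eq_wordElt, wordElt_cons]⟩
  · rintro ⟨x, hx, p, hp, rfl⟩
    exact ⟨_, ⟨x, hx, rfl⟩, p, hp, by rw [eval_eq_wordElt, wordElt_cons]⟩

theorem mem_tileBoundary_iff {n : ℕ} {v : GermVertex} :
    v ∈ tileBoundary n ↔ ∃ x : Letter, x ≠ some .a ∧ v = tip (letterElt x) (n - 1) := by
  simp only [tileBoundary, branchLabels_eq, Set.image_image, Set.mem_image, Set.mem_ofPred_eq,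
    eq_comm]

/-- Sections at `1` of words that start with a tip of a large tile. -/
theorem wordElt_sectionWord_tip {x : Letter} (hx : x ≠ some .a) (m : ℕ) (u : List Letter) :
    wordElt (sectionWord true (x :: (segment (m + 2)).map some ++ u)) =
      wordElt (letterSection true x :: (segment (m + 1)).map some ++ sectionWord true u) := by
  rw [sectionWord_append, sectionWord, flips_of_ne hx, parity, flips_of_ne hx, parity_segment]
  simp [wordElt_sectionWord_segment]

theorem parity_tip {x : Letter} (hx : x ≠ some .a) (m : ℕ) (u : List Letter) :
    parity (x :: (segment (m + 2)).map some ++ u) = parity u := by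
  rw [parity_append, parity, flips_of_ne hx, parity_segment]
  simp

theorem wordElt_sectionWord_tip_self {x : Letter} (hx : x ≠ some .a) (m : ℕ) :
    wordElt (sectionWord true (x :: (segment (m + 2)).map some)) =
      wordElt (letterSection true x :: (segment (m + 1)).map some) := by
  simpa only [List.append_nil, sectionWord_nil] using wordElt_sectionWord_tip hx m []

theorem tip_move {x y : Letter} (m : ℕ) : (tip (letterElt x) m).move (letterElt y) =
    vertex (wordElt (x :: (segment m).map some ++ [y])) := by
  rw [tip_letterElt, move_vertex]
  simp [mul_assoc]

/-- Sections of prefixes of a segment are prefixes of the preceding segment, and branch labels are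
permuted by the section at `1`. -/
theorem section_mem_tile {m : ℕ} {u : List Letter} (h : vertex (wordElt u) ∈ tile (m + 3)) :
    vertex (wordElt (sectionWord true u)) ∈ tile (m + 2) := by
  obtain ⟨x, hx, p, hp, e⟩ := mem_tile_iff.1 h
  obtain ⟨-, e⟩ := vertex_wordElt_eq_iff.1 e
  obtain ⟨q, hq⟩ := hp
  refine mem_tile_iff.2 ⟨letterSection true x, letterSection_true_ne x,
    (sectionWord true (p.map some)).reduceOption, ?_, ?_⟩
  · change _ <+: segment (m + 1)
    rw [← sectionWord_segment]
    change p ++ q = segment (m + 2) at hq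
    rw [← hq, List.map_append, sectionWord_append, List.reduceOption_append]
    exact List.prefix_append _ _
  · rw [e, sectionWord, flips_of_ne hx, wordElt_cons, wordElt_cons, ← eval_eq_wordElt,
      wordElt_reduceOption]
    rfl

theorem exists_letterSection_eq {x : Letter} (hx : x ≠ some .a) :
    ∃ y : Letter, y ≠ some .a ∧ letterSection true y = x := by
  rcases x with _ | _ | _ | _ | _
  · exact ⟨none, by simp, rfl⟩
  · exact absurd rfl hx
  · exact ⟨some .d, by simp, rfl⟩
  · exact ⟨some .b, by simp, rfl⟩
  · exact ⟨some .c, by simp, rfl⟩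

/-- From a boundary point the letters other than `a` do not lead into the interior of the
tile. -/
theorem tip_move_mem_tileBoundary (m : ℕ) {x y : Letter} (hx : x ≠ some .a) (hy : y ≠ some .a)
    (h : (tip (letterElt x) (m + 1)).move (letterElt y) ∈ tile (m + 2)) :
    (tip (letterElt x) (m + 1)).move (letterElt y) ∈ tileBoundary (m + 2) := by
  rw [tip_move] at h ⊢
  induction m generalizing x y with
  | zero =>
    -- In `Ĩ_2` each branch is one `a`-edge, so parity separates origins from boundary points;
    -- letters other than `a` preserve it.
    obtain ⟨z, hz, p, hp, e⟩ := mem_tile_iff.1 h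
    refine mem_tileBoundary_iff.2 ⟨z, hz, ?_⟩
    rw [e, tip_letterElt]
    have hpar := (vertex_wordElt_eq_iff.1 e).1
    simp only [segment, List.map_cons, List.map_nil, List.cons_append, List.nil_append, parity,
      flips_of_ne hx, flips_of_ne hy, flips_of_ne hz] at hpar
    change p <+: [.a] at hp
    have : p = [] ∨ p = [.a] := by
      rcases p with _ | ⟨s, p⟩
      · exact Or.inl rfl
      · right
        obtain ⟨q, hq⟩ := hp
        simp at hq
        simp [hq]
    rcases this with rfl | rfl
    · simp [parity, flips] at hpar
    · rfl
  | succ m ih =>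
    have h1 := section_mem_tile h
    rw [wordElt_sectionWord_tip hx, sectionWord, sectionWord] at h1
    have h2 := ih (letterSection_true_ne x) (letterSection_true_ne y) h1
    obtain ⟨z, hz, e⟩ := mem_tileBoundary_iff.1 h2
    obtain ⟨z', hz', rfl⟩ := exists_letterSection_eq hz
    refine mem_tileBoundary_iff.2 ⟨z', hz', ?_⟩
    change _ = tip (letterElt z') (m + 2)
    rw [tip_letterElt, vertex_wordElt_eq_iff]
    have t := parity_tip hz' m []
    rw [List.append_nil] at t
    rw [parity_tip hx, t, wordElt_sectionWord_tip hx, wordElt_sectionWord_tip_self hz']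
    refine ⟨by simp [parity, flips_of_ne hy], ?_⟩
    rw [sectionWord, sectionWord, e, tip_letterElt]
    rfl

/-! ### Distinctness of the germs of `1, b, c, d` -/

theorem exists_act_ne (N : ℕ) {s : Gen} (hs : s ≠ .a) :
    ∃ x : Cantor, (∀ i < N, x i = true) ∧ act s x ≠ x := by
  induction N generalizing s with
  | zero =>
    cases s
    · exact absurd rfl hs
    · exact ⟨fun _ => false, by simp, fun h => by simpa [act, coord] using congrFun h 1⟩
    · exact ⟨fun _ => false, by simp, fun h => by simpa [act, coord] using congrFun h 1⟩
    · exact ⟨cons true fun _ => false, by simp,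
        fun h => by simpa [act, coord, cons] using congrFun h 2⟩
  | succ N ih =>
    obtain ⟨t, ht, e⟩ : ∃ t : Gen, t ≠ .a ∧ ∀ y, act s (cons true y) = cons true (act t y) := by
      cases s
      · exact absurd rfl hs
      · exact ⟨.c, by simp, fun y => act_cons_b true y⟩
      · exact ⟨.d, by simp, fun y => act_cons_c true y⟩
      · exact ⟨.b, by simp, fun y => act_cons_d true y⟩
    obtain ⟨y, hy, hne⟩ := ih ht
    refine ⟨cons true y, ?_, ?_⟩
    · intro i hi
      cases i with
      | zero => rfl
      | succ i => exact hy i (by omega)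
    · rw [e]
      intro h
      exact hne (cons_inj.1 h).2

theorem vertex_letterElt_ne {x : Letter} (hx : x ≠ some .a) (hx' : x ≠ none) :
    vertex (letterElt x) ≠ vertex 1 := by
  obtain ⟨s, rfl⟩ := Option.ne_none_iff_exists'.1 hx'
  intro h
  rw [vertex_eq_iff] at h
  have key : ∀ N : ℕ, ∃ z : Cantor, (∀ i < N, z i = true) ∧ act s z ≠ z :=
    fun N => exists_act_ne N (by simpa using hx)
  choose z hz hne using key
  have ht : Tendsto z atTop (𝓝 ones) := by
    rw [tendsto_pi_nhds]
    intro i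
    refine tendsto_const_nhds.congr' ?_
    filter_upwards [eventually_gt_atTop i] with N hN
    exact (hz N i hN).symm
  obtain ⟨N, hN⟩ := (ht.eventually h).exists
  exact hne N hN

theorem vertex_letterElt_injective {x y : Letter} (hx : x ≠ some .a) (hy : y ≠ some .a)
    (h : vertex (letterElt x) = vertex (letterElt y)) : x = y := by
  by_contra hne
  have h1 : vertex (letterElt (fourMul x y)) = vertex 1 := by
    rw [letterElt_fourMul hx hy, ← letterElt_mul_self y, vertex_mul_right, h]
  refine vertex_letterElt_ne (fourMul_ne hx hy) ?_ h1
  rcases x with _ | _ | _ | _ | _ <;> rcases y with _ | _ | _ | _ | _ <;> simp_all [fourMul]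

theorem tip_letterElt_injective {x y : Letter} (hx : x ≠ some .a) (hy : y ≠ some .a) {m : ℕ}
    (h : tip (letterElt x) m = tip (letterElt y) m) : x = y :=
  vertex_letterElt_injective hx hy ((vertex_mul_right _).1 h)

/-- A letter other than `a` does not lead from a boundary point to a different one. -/
theorem tip_move_eq_tip (m : ℕ) {x y z : Letter} (hx : x ≠ some .a) (hy : y ≠ some .a)
    (hz : z ≠ some .a)
    (h : (tip (letterElt x) (m + 1)).move (letterElt y) = tip (letterElt z) (m + 1)) :
    x = z := by
  rw [tip_move, tip_letterElt] at h
  induction m generalizing x y z with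
  | zero =>
    have h1 := (vertex_wordElt_eq_iff.1 h).2
    simp only [segment, List.map_cons, List.map_nil, List.cons_append, List.nil_append,
      sectionWord, flips_of_ne hx, flips_of_ne hz] at h1
    have h2 := (vertex_wordElt_eq_iff.1 h1).1
    -- If the section of `y` at `0` were `a`, it would change the second letter of the point,
    -- against `h2`.
    have hf : letterSection false y = none := by
      have hp : xor (flips (letterSection true x)) (xor false (xor (flips (letterSection false y))
        false)) = xor (flips (letterSection true z)) (xor false false) := h2
      rw [flips_of_ne (letterSection_true_ne x), flips_of_ne (letterSection_true_ne z)] at hp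
      rcases y with _ | _ | _ | _ | _ <;> simp_all [flips, letterSection]
    have h3 : vertex (letterElt (letterSection true x)) =
        vertex (letterElt (letterSection true z)) := by
      change vertex (wordElt [letterSection true x, none, letterSection false y]) =
        vertex (wordElt [letterSection true z, none]) at h1
      simpa [hf, letterElt] using h1
    have h4 := vertex_letterElt_injective (letterSection_true_ne x) (letterSection_true_ne z) h3
    rcases x with _ | _ | _ | _ | _ <;> rcases z with _ | _ | _ | _ | _ <;>
      simp_all [letterSection]
  | succ m ih =>
    have h1 := (vertex_wordElt_eq_iff.1 h).2
    rw [wordElt_sectionWord_tip hx, wordElt_sectionWord_tip_self hz, sectionWord, sectionWord] at h1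
    have h4 := ih (letterSection_true_ne x) (letterSection_true_ne y)
      (letterSection_true_ne z) h1
    rcases x with _ | _ | _ | _ | _ <;> rcases z with _ | _ | _ | _ | _ <;>
      simp_all [letterSection]

/-! ### Traverses -/

theorem GermVertex.move_move (v : GermVertex) (g h : grig) :
    (v.move g).move h = v.move (g * h) := by
  induction v using Quotient.inductionOn with
  | _ k => exact congrArg vertex (mul_assoc k g h)

theorem GermVertex.move_one (v : GermVertex) : v.move 1 = v := by
  induction v using Quotient.inductionOn with
  | _ k => exact congrArg vertex (mul_one k)

/-- The position at time `l` of the path that is at the first boundary point of `Ĩ_{k+2}` at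
time `i` and is moved by the letters of `w`. -/
def position (k : ℕ) (w : List Letter) (i l : ℕ) : GermVertex :=
  (tip 1 (k + 1)).move ((wordElt (w.take i))⁻¹ * wordElt (w.take l))

theorem wordElt_drop_take (w : List Letter) {i l : ℕ} (h : i ≤ l) :
    wordElt ((w.take l).drop i) = (wordElt (w.take i))⁻¹ * wordElt (w.take l) := by
  rw [eq_inv_mul_iff_mul_eq, ← wordElt_append]
  congr 1
  conv_rhs => rw [← List.take_append_drop i (w.take l)]
  rw [List.take_take, min_eq_left h]

theorem position_self (k : ℕ) (w : List Letter) (i : ℕ) : position k w i i = tip 1 (k + 1) := by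
  rw [position, inv_mul_cancel, GermVertex.move_one]

theorem position_move (k : ℕ) (w : List Letter) (i l m : ℕ) :
    (position k w i l).move ((wordElt (w.take l))⁻¹ * wordElt (w.take m)) =
      position k w i m := by
  rw [position, position, GermVertex.move_move]
  congr 1
  group

theorem position_trans {k : ℕ} {w : List Letter} {i l : ℕ}
    (h : position k w i l = tip 1 (k + 1)) (m : ℕ) : position k w l m = position k w i m := by
  rw [← position_move k w i l m, h, position]

theorem position_succ {k : ℕ} {w : List Letter} {i l : ℕ} {x : Letter} (h : w[l]? = some x) :
    position k w i (l + 1) = (position k w i l).move (letterElt x) := by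
  rw [← position_move k w i l, List.take_add_one, h]
  simp

theorem position_eq_vertex (k : ℕ) (w : List Letter) {i l : ℕ} (h : i ≤ l) :
    position k w i l =
      vertex (wordElt (none :: (segment (k + 1)).map some ++ (w.take l).drop i)) := by
  rw [position, show (1 : grig) = letterElt none from rfl, tip_letterElt, move_vertex,
    wordElt_append, wordElt_drop_take w h]

theorem tip_mem_tileBoundary {x : Letter} (hx : x ≠ some .a) (k : ℕ) :
    tip (letterElt x) (k + 1) ∈ tileBoundary (k + 2) :=
  mem_tileBoundary_iff.2 ⟨x, hx, rfl⟩

theorem tip_mem_tile {x : Letter} (hx : x ≠ some .a) (k : ℕ) :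
    tip (letterElt x) (k + 1) ∈ tile (k + 2) :=
  mem_tile_iff.2 ⟨x, hx, _, List.prefix_rfl, tip_letterElt _ _⟩

/-- The word `w` traverses `Ĩ_{k+2}` from the branch `1` to the branch `x` between the times
`i` and `j`. -/
structure IsTraverse (k : ℕ) (x : Letter) (w : List Letter) (i j : ℕ) : Prop where
  lt : i < j
  le : j ≤ w.length
  exit : position k w i j = tip (letterElt x) (k + 1)
  mem : ∀ l, i < l → l < j → position k w i l ∈ tile (k + 2)
  notMem : ∀ l, i < l → l < j → position k w i l ∉ tileBoundary (k + 2)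

/-- The times at which traverses of `Ĩ_{k+2}` start. -/
def starts (k : ℕ) (w : List Letter) : Set ℕ :=
  {i | ∃ x : Letter, x ≠ some .a ∧ x ≠ none ∧ ∃ j, IsTraverse k x w i j}

theorem starts_finite (k : ℕ) (w : List Letter) : (starts k w).Finite := by
  refine (Set.finite_Iio w.length).subset ?_
  rintro i ⟨x, -, -, j, h⟩
  exact h.lt.trans_le h.le

/-- The exit is the first visit to the boundary after the start. Hence counting traverses reduces to
counting start times. -/
theorem IsTraverse.unique {k : ℕ} {x x' : Letter} {w : List Letter} {i j j' : ℕ}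
    (h : IsTraverse k x w i j) (h' : IsTraverse k x' w i j') (hx : x ≠ some .a)
    (hx' : x' ≠ some .a) : j = j' ∧ x = x' := by
  have hj : j = j' := by
    rcases lt_trichotomy j j' with hlt | e | hlt
    · refine absurd ?_ (h'.notMem j h.lt hlt)
      rw [h.exit]
      exact tip_mem_tileBoundary hx k
    · exact e
    · refine absurd ?_ (h.notMem j' h'.lt hlt)
      rw [h'.exit]
      exact tip_mem_tileBoundary hx' k
  subst hj
  exact ⟨rfl, tip_letterElt_injective hx hx' (h.exit.symm.trans h'.exit)⟩

theorem mem_traverses_iff {k : ℕ} {s : Gen} {w : List Gen} {p : ℕ × ℕ} :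
    p ∈ traverses (k + 2) (gen s) w ↔ IsTraverse k (some s) (w.map some) p.1 p.2 := by
  have hp : ∀ l, p.1 ≤ l → (tip 1 (k + 2 - 1)).move (eval ((w.take l).drop p.1)) =
      position k (w.map some) p.1 l := by
    intro l hl
    rw [eval_eq_wordElt, List.map_drop, List.map_take, wordElt_drop_take _ hl, position]
    rfl
  constructor
  · rintro ⟨h1, h2, h3, h4⟩
    refine ⟨h1, by simpa using h2, ?_, fun l hl hl' => ?_, fun l hl hl' => ?_⟩
    · rw [← hp _ h1.le, h3]; rfl
    · rw [← hp _ hl.le]; exact (h4 l hl hl').1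
    · rw [← hp _ hl.le]; exact (h4 l hl hl').2
  · intro h
    refine ⟨h.lt, by simpa using h.le, ?_, fun l hl hl' => ?_⟩
    · rw [hp _ h.lt.le, h.exit]; rfl
    · rw [hp _ hl.le]; exact ⟨h.mem l hl hl', h.notMem l hl hl'⟩

theorem traverseCount_le (k : ℕ) (w : List Gen) :
    traverseCount (k + 2) w ≤ (starts k (w.map some)).ncard := by
  classical
  let A : Gen → Set ℕ := fun s => Prod.fst '' traverses (k + 2) (gen s) w
  have hA : ∀ s, s ≠ .a → A s ⊆ starts k (w.map some) := by
    rintro s hs _ ⟨p, hp, rfl⟩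
    exact ⟨some s, by simpa using hs, by simp, p.2, mem_traverses_iff.1 hp⟩
  have hfin : ∀ s, s ≠ .a → (A s).Finite := fun s hs => (starts_finite _ _).subset (hA s hs)
  have hcard : ∀ s, s ≠ .a → (traverses (k + 2) (gen s) w).ncard = (A s).ncard := by
    intro s hs
    refine (Set.InjOn.ncard_image ?_).symm
    intro p hp q hq e
    have hp := mem_traverses_iff.1 hp
    have hq := mem_traverses_iff.1 hq
    rw [e] at hp
    exact Prod.ext e (hp.unique hq (by simpa using hs) (by simpa using hs)).1
  have hdisj : ∀ s t, s ≠ .a → t ≠ .a → s ≠ t → Disjoint (A s) (A t) := by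
    intro s t hs ht hst
    rw [Set.disjoint_left]
    rintro _ ⟨p, hp, rfl⟩ ⟨q, hq, e⟩
    have hp := mem_traverses_iff.1 hp
    have hq := mem_traverses_iff.1 hq
    rw [e] at hq
    exact hst (Option.some.inj (hp.unique hq (by simpa using hs) (by simpa using ht)).2)
  have hb : Gen.b ≠ .a := by decide
  have hc : Gen.c ≠ .a := by decide
  have hd : Gen.d ≠ .a := by decide
  rw [traverseCount, Finset.sum_insert (by decide), Finset.sum_insert (by decide),
    Finset.sum_singleton, hcard _ hb, hcard _ hc, hcard _ hd,
    ← Set.ncard_union_eq (hdisj .c .d hc hd (by decide)) (hfin _ hc) (hfin _ hd),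
    ← Set.ncard_union_eq (Set.disjoint_union_right.2
      ⟨hdisj .b .c hb hc (by decide), hdisj .b .d hb hd (by decide)⟩) (hfin _ hb)
      ((hfin _ hc).union (hfin _ hd))]
  exact Set.ncard_le_ncard (Set.union_subset (hA _ hb) (Set.union_subset (hA _ hc) (hA _ hd)))
    (starts_finite _ _)

/-- Any other letter, applied at a boundary point, cannot enter the interior, nor can it reach a
different boundary point in one step. -/
theorem IsTraverse.first {k : ℕ} {x : Letter} {w : List Letter} {i j : ℕ}
    (h : IsTraverse k x w i j) (hx : x ≠ some .a) (hx' : x ≠ none) :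
    w[i]? = some (some .a) := by
  obtain ⟨y, hy⟩ : ∃ y, w[i]? = some y :=
    ⟨_, List.getElem?_eq_getElem (h.lt.trans_le h.le)⟩
  have hpos := position_succ (k := k) (i := i) hy
  rw [position_self, ← letterElt_none] at hpos
  rw [hy]
  by_contra hya
  replace hya : y ≠ some .a := fun e => hya (by rw [e])
  have hn : (none : Letter) ≠ some .a := by simp
  rcases (Nat.succ_le_of_lt h.lt).eq_or_lt with e | hlt
  · subst e
    have := h.exit
    rw [hpos] at this
    exact hx' (tip_move_eq_tip k hn hya hx this).symm
  · have h1 := h.mem _ (Nat.lt_succ_self i) hlt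
    have h2 := h.notMem _ (Nat.lt_succ_self i) hlt
    rw [Nat.succ_eq_add_one, hpos] at h1 h2
    exact h2 (tip_move_mem_tileBoundary k hn hya h1)

/-- Letters are involutions, so the last step can be read backwards from the exit. -/
theorem IsTraverse.last {k : ℕ} {x : Letter} {w : List Letter} {i j : ℕ}
    (h : IsTraverse k x w i (j + 1)) (hx : x ≠ some .a) (hx' : x ≠ none) :
    w[j]? = some (some .a) := by
  rcases (Nat.lt_succ_iff.1 h.lt).eq_or_lt with e | hlt
  · subst e
    exact h.first hx hx'
  obtain ⟨y, hy⟩ : ∃ y, w[j]? = some y := ⟨_, List.getElem?_eq_getElem h.le⟩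
  have hpos := position_succ (k := k) (i := i) hy
  rw [h.exit] at hpos
  have hpos' : (tip (letterElt x) (k + 1)).move (letterElt y) = position k w i j := by
    rw [hpos, GermVertex.move_move, letterElt_mul_self, GermVertex.move_one]
  rw [hy]
  by_contra hya
  replace hya : y ≠ some .a := fun e => hya (by rw [e])
  have h1 := h.mem _ hlt (Nat.lt_succ_self j)
  have h2 := h.notMem _ hlt (Nat.lt_succ_self j)
  rw [← hpos'] at h1 h2
  exact h2 (tip_move_mem_tileBoundary k hx hya h1)

/-! ### Traverses of merged words -/

/-- The new path differs only at time `m + 1`, where it still waits at the old position of time `m`.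
No traverse starts at `m` or `m + 1` or ends at `m + 1`, since traverses start and end with an `a`;
so all of them survive with unchanged times. -/
theorem starts_subset_of_delay {k : ℕ} {w w' : List Letter} (hlen : w'.length = w.length) {m : ℕ}
    (hm : w[m]? ≠ some (some .a)) (hm' : w[m + 1]? ≠ some (some .a))
    (he : ∀ l, l ≠ m + 1 → l ≤ w.length → wordElt (w'.take l) = wordElt (w.take l))
    (hd : wordElt (w'.take (m + 1)) = wordElt (w.take m)) : starts k w ⊆ starts k w' := by
  rintro i ⟨x, hx, hx', j, h⟩
  have h1 := h.first hx hx'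
  have him : i ≠ m := by rintro rfl; exact hm h1
  have him' : i ≠ m + 1 := by rintro rfl; exact hm' h1
  have hj : j ≠ m + 1 := by rintro rfl; exact hm (h.last hx hx')
  have hi := h.lt.le.trans h.le
  have hp : ∀ l, l ≠ m + 1 → l ≤ j → position k w' i l = position k w i l := by
    intro l hl hl'
    rw [position, he i him' hi, he l hl (hl'.trans h.le), position]
  have hp' : position k w' i (m + 1) = position k w i m := by
    rw [position, he i him' hi, hd, position]
  refine ⟨x, hx, hx', j, h.lt, hlen ▸ h.le, (hp j hj le_rfl).trans h.exit, ?_, ?_⟩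
  · intro l hl hl'
    by_cases e : l = m + 1
    · subst e; rw [hp']; exact h.mem m (by omega) (by omega)
    · rw [hp l e hl'.le]; exact h.mem l hl hl'
  · intro l hl hl'
    by_cases e : l = m + 1
    · subst e; rw [hp']; exact h.notMem m (by omega) (by omega)
    · rw [hp l e hl'.le]; exact h.notMem l hl hl'

/-- Each elementary merge delays one letter by one unit of time. The prefix `u` is the part already
processed. -/
theorem starts_append_merge (k : ℕ) (u w : List Letter) :
    starts k (u ++ w) ⊆ starts k (u ++ merge w) := by
  induction w using merge_induction generalizing u with
  | nil => rw [merge_nil]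
  | cons_a l ih =>
    rw [merge_a, List.append_cons, List.append_cons u _ (merge l)]
    exact ih _
  | single x hx =>
    rw [merge_single hx]
    refine starts_subset_of_delay (m := u.length) (by simp) (by simpa using hx) (by simp) ?_ ?_
    · intro l hl hl'
      rw [List.length_append, List.length_singleton] at hl'
      rw [List.take_append_of_le_length (by omega), List.take_append_of_le_length (by omega)]
    · rw [List.take_of_length_le (by simp), List.take_left]
      simp [letterElt]
  | cons_cons_a x l hx ih => simpa [merge_cons_a hx] using ih (u ++ [x, some .a])
  | cons_cons x y l hx hy ih =>
    rw [merge_cons_cons hx hy]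
    have h1 := ih (u ++ [none])
    rw [List.append_assoc, List.append_assoc] at h1
    refine subset_trans ?_ h1
    refine starts_subset_of_delay (m := u.length) (by simp) (by simpa using hx)
      (by simpa using hy) ?_ ?_
    · intro l' hl _
      rcases lt_or_ge l' (u.length + 1) with h | h
      · rw [List.take_append_of_le_length (by omega), List.take_append_of_le_length (by omega)]
      · obtain ⟨q, rfl⟩ : ∃ q, l' = u.length + (q + 2) := ⟨l' - u.length - 2, by omega⟩
        simp [List.take_length_add_append, letterElt_fourMul hx hy, letterElt_none, mul_assoc]
    · rw [List.take_left, List.take_length_add_append]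
      simp [letterElt]

/-! ### Traverses of sections -/

/-- The section at `1` of the path of a traverse is a path in the smaller tile, which is moved by
the letters of a section of the word. -/
theorem section_position (k : ℕ) {w : List Letter} {i l : ℕ} (h : i ≤ l) :
    ∃ u, position (k + 1) w i l = vertex (wordElt u) ∧
      parity u = xor (parity (w.take i)) (parity (w.take l)) ∧
      position k (sectionWord (!parity (w.take i)) w) i l =
        vertex (wordElt (sectionWord true u)) := by
  have hn : (none : Letter) ≠ some .a := by simp
  refine ⟨_, position_eq_vertex (k + 1) w h, ?_, ?_⟩
  · rw [parity_tip hn]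
    conv_rhs => rw [← List.take_append_drop i (w.take l), List.take_take, min_eq_left h,
      parity_append]
    simp
  · rw [position_eq_vertex k _ h, wordElt_sectionWord_tip hn, ← sectionWord_take,
      ← sectionWord_drop, List.take_take, min_eq_left h]
    simp [letterSection]

theorem tip_section {x : Letter} (hx : x ≠ some .a) {k : ℕ} {u : List Letter}
    (h : vertex (wordElt u) = tip (letterElt x) (k + 2)) :
    vertex (wordElt (sectionWord true u)) = tip (letterElt (letterSection true x)) (k + 1) := by
  rw [tip_letterElt] at h
  rw [(vertex_wordElt_eq_iff.1 h).2, wordElt_sectionWord_tip_self hx, tip_letterElt]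

/-- A path in a tile from the boundary point in the branch `1` to another boundary point contains
a traverse. -/
theorem exists_mem_starts {k : ℕ} {w : List Letter} {i j : ℕ} (hij : i < j) (hj : j ≤ w.length)
    {x : Letter} (hx : x ≠ some .a) (hx' : x ≠ none)
    (hexit : position k w i j = tip (letterElt x) (k + 1))
    (hmem : ∀ l, i ≤ l → l ≤ j → position k w i l ∈ tile (k + 2)) :
    ∃ m ∈ starts k w, i ≤ m ∧ m < j ∧ position k w i m = tip 1 (k + 1) := by
  classical
  have hn : (none : Letter) ≠ some .a := by simp
  -- The traverse runs from the last visit `m` to the initial point before `j` to the first boundary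
  -- visit `n` after `m`; maximality of `m` keeps `n` from being another visit to the initial point.
  let A := (Finset.Ico i j).filter fun l => position k w i l = tip 1 (k + 1)
  have hA : A.Nonempty := ⟨i, by simp [A, hij, position_self]⟩
  let m := A.max' hA
  obtain ⟨hm1, hm2⟩ := Finset.mem_filter.1 (A.max'_mem hA)
  change m ∈ _ at hm1
  change position k w i m = _ at hm2
  rw [Finset.mem_Ico] at hm1
  have hex : ∃ l, m < l ∧ l ≤ j ∧ position k w i l ∈ tileBoundary (k + 2) :=
    ⟨j, hm1.2, le_rfl, hexit ▸ tip_mem_tileBoundary hx k⟩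
  let n := Nat.find hex
  obtain ⟨hn1, hn2, hn3⟩ := Nat.find_spec hex
  change m < n at hn1
  change n ≤ j at hn2
  change position k w i n ∈ _ at hn3
  obtain ⟨y, hy, hy'⟩ := mem_tileBoundary_iff.1 hn3
  change _ = tip (letterElt y) (k + 1) at hy'
  have hyn : y ≠ none := by
    rintro rfl
    rcases hn2.eq_or_lt with e | hlt
    · rw [e, hexit] at hy'
      exact hx' (tip_letterElt_injective hx hn hy')
    · have : n ∈ A := by
        rw [Finset.mem_filter, Finset.mem_Ico]
        exact ⟨⟨by omega, hlt⟩, hy'⟩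
      exact absurd (A.le_max' n this) (not_le.2 hn1)
  refine ⟨m, ⟨y, hy, hyn, n, hn1, hn2.trans hj, ?_, ?_, ?_⟩, hm1.1, hm1.2, hm2⟩
  · rw [position_trans hm2, hy']
  · intro l hl hl'
    rw [position_trans hm2]
    exact hmem l (by omega) (by omega)
  · intro l hl hl'
    rw [position_trans hm2]
    exact fun h => Nat.find_min hex hl' ⟨hl, by omega, h⟩

/-- At time `i` the path has first letter `1`, so its section follows the section of `w` at the
letter that `w.take i` carries to `1`, namely `!parity (w.take i)`. The last clause, which holds
because `m` precedes the exit, makes `i` recoverable from `m`. -/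
theorem exists_section_start {k : ℕ} {w : List Letter} {i : ℕ} (hi : i ∈ starts (k + 1) w) :
    ∃ m ∈ starts k (sectionWord (!parity (w.take i)) w), i ≤ m ∧
      position k (sectionWord (!parity (w.take i)) w) i m = tip 1 (k + 1) ∧
      ∀ l, i < l → l ≤ m → position (k + 1) w i l ∉ tileBoundary (k + 3) := by
  have hn : (none : Letter) ≠ some .a := by simp
  obtain ⟨x, hx, hx', j, h⟩ := hi
  have hexit : position k (sectionWord (!parity (w.take i)) w) i j =
      tip (letterElt (letterSection true x)) (k + 1) := by
    obtain ⟨u, hu, -, hu'⟩ := section_position k (w := w) h.lt.le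
    rw [hu', tip_section hx (hu ▸ h.exit)]
  have hne : letterSection true x ≠ none := by
    rcases x with _ | _ | _ | _ | _ <;> simp_all [letterSection]
  obtain ⟨m, hm, him, hmj, hpos⟩ := exists_mem_starts h.lt
    (by rw [sectionWord_length]; exact h.le) (letterSection_true_ne x) hne hexit (by
      intro l hl hl'
      rcases hl.eq_or_lt with rfl | hl
      · rw [position_self, ← letterElt_none]
        exact tip_mem_tile hn k
      rcases hl'.eq_or_lt with rfl | hl'
      · rw [hexit]
        exact tip_mem_tile (letterSection_true_ne x) k
      obtain ⟨u, hu, -, hu'⟩ := section_position k (w := w) hl.le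
      rw [hu']
      exact section_mem_tile (hu ▸ h.mem l hl hl'))
  exact ⟨m, hm, him, hpos, fun l hl hl' => h.notMem l hl (by omega)⟩

theorem ncard_starts_succ_le (k : ℕ) (w : List Letter) :
    (starts (k + 1) w).ncard ≤
      (starts k (sectionWord false w)).ncard + (starts k (sectionWord true w)).ncard := by
  have hn : (none : Letter) ≠ some .a := by simp
  have key : ∀ b, (starts (k + 1) w ∩ {i | (!parity (w.take i)) = b}).ncard ≤
      (starts k (sectionWord b w)).ncard := by
    intro b
    have hex : ∀ i : ℕ, ∃ m, i ∈ starts (k + 1) w ∩ {i | (!parity (w.take i)) = b} →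
        m ∈ starts k (sectionWord b w) ∧ i ≤ m ∧
        position k (sectionWord b w) i m = tip 1 (k + 1) ∧
        ∀ l, i < l → l ≤ m → position (k + 1) w i l ∉ tileBoundary (k + 3) := by
      intro i
      by_cases hi : i ∈ starts (k + 1) w ∩ {i | (!parity (w.take i)) = b}
      · obtain ⟨m, h1, h2, h3⟩ := exists_section_start hi.1
        have hb : (!parity (w.take i)) = b := hi.2
        rw [hb] at h1 h3
        exact ⟨m, fun _ => ⟨h1, h2, h3⟩⟩
      · exact ⟨0, fun h => absurd h hi⟩
    choose f hf using hex
    refine Set.ncard_le_ncard_of_injOn f (fun i hi => (hf i hi).1) ?_ (starts_finite _ _)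
    have hlt : ∀ i ∈ starts (k + 1) w ∩ {i | (!parity (w.take i)) = b},
        ∀ i' ∈ starts (k + 1) w ∩ {i | (!parity (w.take i)) = b},
        f i = f i' → ¬ i < i' := by
      intro i hi i' hi' e hii'
      obtain ⟨-, h1, h2, h3⟩ := hf i hi
      obtain ⟨-, h1', h2', -⟩ := hf i' hi'
      rw [← e] at h1' h2'
      have hb : (!parity (w.take i)) = b := hi.2
      have hb' : (!parity (w.take i')) = b := hi'.2
      obtain ⟨u, hu, hu1, hu2⟩ := section_position k (w := w) h1
      obtain ⟨u', hu', hu1', hu2'⟩ := section_position k (w := w) h1'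
      rw [hb, h2] at hu2
      rw [hb', h2'] at hu2'
      -- At time `f i` both paths have the same first letter and the same section germ, hence
      -- coincide. Moved back to time `i'`, the path from `i` is at the initial boundary point,
      -- against `h3`.
      have he : position (k + 1) w i (f i) = position (k + 1) w i' (f i) := by
        rw [hu, hu', vertex_wordElt_eq_iff, ← hu2, ← hu2', hu1, hu1']
        refine ⟨?_, rfl⟩
        rw [Bool.not_inj (hb.trans hb'.symm)]
      refine h3 i' hii' h1' ?_
      have := congrArg (fun v => v.move ((wordElt (w.take (f i)))⁻¹ * wordElt (w.take i'))) he
      simp only [position_move, position_self] at this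
      rw [this, ← letterElt_none]
      exact tip_mem_tileBoundary hn (k + 1)
    intro i hi i' hi' e
    exact le_antisymm (not_lt.1 (hlt i' hi' i hi e.symm)) (not_lt.1 (hlt i hi i' hi' e))
  have hsub : starts (k + 1) w ⊆ starts (k + 1) w ∩ {i | (!parity (w.take i)) = false} ∪
      starts (k + 1) w ∩ {i | (!parity (w.take i)) = true} := by
    intro i hi
    cases h : !parity (w.take i)
    · exact Or.inl ⟨hi, h⟩
    · exact Or.inr ⟨hi, h⟩
  refine (Set.ncard_le_ncard hsub (((starts_finite _ _).inter_of_left _).union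
    ((starts_finite _ _).inter_of_left _))).trans ((Set.ncard_union_le _ _).trans ?_)
  exact add_le_add (key false) (key true)

/-! ### Exponential decay of the traverse counts and the generating function -/

theorem ncard_a_le {η : ℝ} (h0 : 0 < η) (hη : η ^ 3 + η ^ 2 + η - 2 = 0) (w : List Letter) :
    {i : ℕ | w[i]? = some (some Gen.a)}.Finite ∧
      ({i : ℕ | w[i]? = some (some Gen.a)}.ncard : ℝ) * letterWeight η (some .a) ≤ weight η w := by
  induction w with
  | nil => simp
  | cons l w ih =>
    obtain ⟨hfin, ih⟩ := ih
    rw [weight_cons]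
    have hs : {i : ℕ | (l :: w)[i]? = some (some Gen.a)} =
        {i | i = 0 ∧ l = some .a} ∪ Nat.succ '' {i : ℕ | w[i]? = some (some Gen.a)} := by
      ext i
      cases i <;> simp
    have hc : (Nat.succ '' {i : ℕ | w[i]? = some (some Gen.a)}).ncard =
        {i : ℕ | w[i]? = some (some Gen.a)}.ncard := Set.ncard_image_of_injective _ Nat.succ_injective
    have hu := Set.ncard_union_le {i | i = 0 ∧ l = some .a}
      (Nat.succ '' {i : ℕ | w[i]? = some (some Gen.a)})
    have hf0 : {i | i = 0 ∧ l = some .a}.Finite :=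
      (Set.finite_singleton 0).subset fun i hi => hi.1
    rw [← hs, hc] at hu
    refine ⟨hs ▸ hf0.union (hfin.image _), ?_⟩
    have hpa := letterWeight_nonneg h0 hη (some .a)
    have h1 : ({i : ℕ | i = 0 ∧ l = some .a}.ncard : ℝ) * letterWeight η (some .a) ≤
        letterWeight η l := by
      by_cases hl : l = some .a
      · subst hl; simp
      · simpa [hl] using letterWeight_nonneg h0 hη l
    have hu' : ({i : ℕ | (l :: w)[i]? = some (some Gen.a)}.ncard : ℝ) ≤
        ({i : ℕ | i = 0 ∧ l = some .a}.ncard : ℝ) + {i : ℕ | w[i]? = some (some Gen.a)}.ncard := by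
      exact_mod_cast hu
    nlinarith

/-- Each step down merges, passes to the two sections and gains a factor `η`; at level `0` the
starts are among the positions of `a`. -/
theorem ncard_starts_le {η : ℝ} (h0 : 0 < η) (hη : η ^ 3 + η ^ 2 + η - 2 = 0) (k : ℕ)
    (w : List Letter) :
    ((starts k w).ncard : ℝ) * letterWeight η (some .a) ≤ η ^ k * weight η w := by
  induction k generalizing w with
  | zero =>
    rw [pow_zero, one_mul]
    obtain ⟨hfin, h⟩ := ncard_a_le h0 hη w
    refine (mul_le_mul_of_nonneg_right ?_ (letterWeight_nonneg h0 hη _)).trans h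
    have hsub : starts 0 w ⊆ {i : ℕ | w[i]? = some (some Gen.a)} :=
      fun i ⟨x, hx, hx', j, hj⟩ => hj.first hx hx'
    exact_mod_cast Set.ncard_le_ncard hsub hfin
  | succ k ih =>
    have h1 : (starts (k + 1) w).ncard ≤ (starts k (sectionWord false (merge w))).ncard +
        (starts k (sectionWord true (merge w))).ncard :=
      (Set.ncard_le_ncard (starts_append_merge (k + 1) [] w) (starts_finite _ _)).trans
        (ncard_starts_succ_le k _)
    have h2 : ((starts (k + 1) w).ncard : ℝ) ≤ (starts k (sectionWord false (merge w))).ncard +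
        (starts k (sectionWord true (merge w))).ncard := by exact_mod_cast h1
    have h3 := ih (sectionWord false (merge w))
    have h4 := ih (sectionWord true (merge w))
    have h5 := weight_merge_sections h0 hη w false
    calc _ ≤ _ := mul_le_mul_of_nonneg_right h2 (letterWeight_nonneg h0 hη (some .a))
      _ ≤ η ^ k * (weight η (sectionWord false (merge w)) +
          weight η (sectionWord true (merge w))) := by linarith
      _ ≤ η ^ k * (η * weight η w) := mul_le_mul_of_nonneg_left h5 (by positivity)
      _ = _ := by ring

theorem traverseCount_le_pow {η : ℝ} (h0 : 0 < η) (hη : η ^ 3 + η ^ 2 + η - 2 = 0) (k : ℕ)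
    (w : List Gen) :
    (traverseCount (k + 2) w : ℝ) ≤ w.length / (1 - η ^ 3) * η ^ k := by
  have h3 : 0 < 1 - η ^ 3 := sub_pos.2 (pow_lt_one₀ h0.le (root_lt_one h0 hη) (by norm_num))
  have h1 : (traverseCount (k + 2) w : ℝ) ≤ (starts k (w.map some)).ncard := by
    exact_mod_cast traverseCount_le k w
  have h2 := ncard_starts_le h0 hη k (w.map some)
  have h4 := weight_le_length h0 hη (w.map some)
  rw [List.length_map] at h4
  rw [div_mul_eq_mul_div, le_div_iff₀ h3]
  calc _ ≤ _ := mul_le_mul_of_nonneg_right h1 h3.le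
    _ ≤ _ := h2
    _ ≤ η ^ k * w.length := mul_le_mul_of_nonneg_left h4 (by positivity)
    _ = _ := mul_comm _ _

theorem finite_traverseCount_ne_zero {η : ℝ} (h0 : 0 < η) (hη : η ^ 3 + η ^ 2 + η - 2 = 0)
    (w : List Gen) : {n : ℕ | traverseCount (n + 2) w ≠ 0}.Finite := by
  have ht : Filter.Tendsto (fun n : ℕ => w.length / (1 - η ^ 3) * η ^ n) Filter.atTop
      (nhds (w.length / (1 - η ^ 3) * 0)) :=
    (tendsto_pow_atTop_nhds_zero_of_lt_one h0.le (root_lt_one h0 hη)).const_mul _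
  rw [mul_zero] at ht
  have he := ht.eventually (gt_mem_nhds zero_lt_one)
  rw [← Nat.cofinite_eq_atTop, Filter.eventually_cofinite] at he
  refine he.subset fun n hn hlt => hn ?_
  have : (traverseCount (n + 2) w : ℝ) < 1 := (traverseCount_le_pow h0 hη n w).trans_lt hlt
  exact Nat.lt_one_iff.1 (by exact_mod_cast this)

theorem traverseSeries_le {η : ℝ} (h0 : 0 < η) (hη : η ^ 3 + η ^ 2 + η - 2 = 0) (w : List Gen)
    {t : ℝ} (ht : 0 < t) (ht' : t < η⁻¹) :
    traverseSeries w t ≤ w.length / (1 - η ^ 3) * (t ^ 2 / (1 - η * t)) := by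
  have hlt : η * t < 1 := by
    have := mul_lt_mul_of_pos_left ht' h0
    rwa [mul_inv_cancel₀ h0.ne'] at this
  have hg : HasSum (fun n : ℕ => w.length / (1 - η ^ 3) * (t ^ 2 * (η * t) ^ n))
      (w.length / (1 - η ^ 3) * (t ^ 2 * (1 - η * t)⁻¹)) :=
    ((hasSum_geometric_of_lt_one (by positivity) hlt).mul_left _).mul_left _
  rw [div_eq_mul_inv (t ^ 2), ← hg.tsum_eq]
  refine Summable.tsum_le_tsum (fun n => ?_) ?_ hg.summable
  · calc _ ≤ w.length / (1 - η ^ 3) * η ^ n * t ^ (n + 2) :=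
        mul_le_mul_of_nonneg_right (traverseCount_le_pow h0 hη n w) (by positivity)
      _ = _ := by rw [mul_pow]; ring
  · refine summable_of_hasFiniteSupport ((finite_traverseCount_ne_zero h0 hη w).subset ?_)
    intro n hn h
    exact hn (by simp [h])

theorem exists_polynomial_traverseSeries_le {η : ℝ} (h0 : 0 < η)
    (hη : η ^ 3 + η ^ 2 + η - 2 = 0) :
    ∃ P : Polynomial ℝ, ∀ (w : List Gen) (t : ℝ), 0 < t → t < η⁻¹ →
      0 < t⁻¹ + (t ^ 2)⁻¹ + (t ^ 3)⁻¹ - 2 ∧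
      traverseSeries w t ≤
        (w.length : ℝ) * ((P.eval t / t ^ 3) / (t⁻¹ + (t ^ 2)⁻¹ + (t ^ 3)⁻¹ - 2)) := by
  -- The last factor is the quotient of `1 + t + t^2 - 2 t^3` by `1 - η t`; the others come from the
  -- bound `traverseSeries_le`.
  refine ⟨.C (1 - η ^ 3)⁻¹ * .X ^ 2 *
    (1 + .C (1 + η) * .X + .C (1 + η + η ^ 2) * .X ^ 2), fun w t ht ht' => ?_⟩
  have hlt : 0 < 1 - η * t := by
    have := mul_lt_mul_of_pos_left ht' h0
    rw [mul_inv_cancel₀ h0.ne'] at this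
    linarith
  have hq : 0 < 1 + (1 + η) * t + (1 + η + η ^ 2) * t ^ 2 := by positivity
  have hd : t⁻¹ + (t ^ 2)⁻¹ + (t ^ 3)⁻¹ - 2 =
      (1 - η * t) * (1 + (1 + η) * t + (1 + η + η ^ 2) * t ^ 2) / t ^ 3 := by
    field_simp
    linear_combination t ^ 3 * hη
  refine ⟨by rw [hd]; positivity, (traverseSeries_le h0 hη w ht ht').trans_eq ?_⟩
  rw [hd]
  simp only [Polynomial.eval_mul, Polynomial.eval_C, Polynomial.eval_pow, Polynomial.eval_X,
    Polynomial.eval_add, Polynomial.eval_one]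
  have h3 : 1 - η ^ 3 ≠ 0 :=
    (sub_pos.2 (pow_lt_one₀ h0.le (root_lt_one h0 hη) (by norm_num))).ne'
  field_simp

/-! ### Growth -/

/-- The elements of weighted length at most `R`. -/
def ball (η R : ℝ) : Set grig := {g | ∃ w, wordElt w = g ∧ weight η w ≤ R}

theorem ball_mono (η : ℝ) {R R' : ℝ} (h : R ≤ R') : ball η R ⊆ ball η R' :=
  fun _ ⟨w, hw, hw'⟩ => ⟨w, hw, hw'.trans h⟩

theorem one_mem_ball (η : ℝ) {R : ℝ} (h : 0 ≤ R) : (1 : grig) ∈ ball η R := ⟨[], rfl, by simpa⟩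

instance : Fintype Gen := ⟨{.a, .b, .c, .d}, fun s => by cases s <;> decide⟩

theorem weight_reduceOption_ge {η : ℝ} (h0 : 0 < η) (hη : η ^ 3 + η ^ 2 + η - 2 = 0)
    (w : List Letter) : (1 - η) * w.reduceOption.length ≤ weight η w := by
  have h1 := root_lt_one h0 hη
  have h2 : η ^ 2 ≤ η := by nlinarith
  have h3 : η ^ 3 ≤ η ^ 2 := by nlinarith
  induction w with
  | nil => simp
  | cons l w ih =>
    rw [weight_cons]
    rcases l with _ | s
    · simpa [letterWeight] using ih
    · have : 1 - η ≤ letterWeight η (some s) := by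
        cases s <;> simp only [letterWeight] <;> linarith
      rw [List.reduceOption_cons_of_some, List.length_cons]
      push_cast
      linarith

theorem finite_ball {η : ℝ} (h0 : 0 < η) (hη : η ^ 3 + η ^ 2 + η - 2 = 0) (R : ℝ) :
    (ball η R).Finite := by
  have h1 : 0 < 1 - η := sub_pos.2 (root_lt_one h0 hη)
  refine ((List.finite_length_le Gen ⌊R / (1 - η)⌋₊).image eval).subset ?_
  rintro g ⟨w, rfl, hw⟩
  refine ⟨w.reduceOption, Nat.le_floor ?_, wordElt_reduceOption w⟩
  rw [le_div_iff₀ h1, mul_comm]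
  exact (weight_reduceOption_ge h0 hη w).trans hw

theorem growth_le_ncard_ball {η : ℝ} (h0 : 0 < η) (hη : η ^ 3 + η ^ 2 + η - 2 = 0) (R : ℝ) :
    growth R ≤ (ball η R).ncard := by
  refine Set.ncard_le_ncard ?_ (finite_ball h0 hη R)
  rintro g ⟨l, hl, hR, rfl⟩
  have hl' : l ∈ Set.range (List.map gen) := by rw [Set.range_list_map]; exact hl
  obtain ⟨w, rfl⟩ := hl'
  refine ⟨w.map some, (eval_eq_wordElt w).symm, (weight_le_length h0 hη _).trans ?_⟩
  simpa using hR

/-- An element is encoded by the letter lost in merging (5 values), the parity (2 values) and the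
two sections, whence the factor 10. The index `k` is the integer part of the weight of the section
at `0`. -/
theorem ncard_ball_le {η : ℝ} (h0 : 0 < η) (hη : η ^ 3 + η ^ 2 + η - 2 = 0) (R : ℝ) :
    (ball η R).ncard ≤ 10 * ∑ k ∈ Finset.range (⌊η * R⌋₊ + 1),
      (ball η (k + 1)).ncard * (ball η (η * R - k)).ncard := by
  classical
  have hex : ∀ g : grig, ∃ p : Letter × Bool × grig × grig, g ∈ ball η R →
      ∃ w : List Letter, g = wordElt w * letterElt p.1 ∧ p.2.1 = parity w ∧
        p.2.2.1 = wordElt (sectionWord false w) ∧ p.2.2.2 = wordElt (sectionWord true w) ∧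
        weight η (sectionWord false w) + weight η (sectionWord true w) ≤ η * R := by
    intro g
    by_cases hg : g ∈ ball η R
    · obtain ⟨w, rfl, hw⟩ := hg
      obtain ⟨x, hx⟩ := wordElt_merge w
      exact ⟨(x, _, _, _), fun _ => ⟨merge w, hx, rfl, rfl, rfl,
        (weight_merge_sections h0 hη w false).trans (mul_le_mul_of_nonneg_left hw h0.le)⟩⟩
    · exact ⟨(none, false, 1, 1), fun h => absurd h hg⟩
  choose f hf using hex
  let B : ℝ → Finset grig := fun r => (finite_ball h0 hη r).toFinset
  have hB : ∀ r, (ball η r).ncard = (B r).card := fun r => Set.ncard_eq_toFinset_card _ _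
  let T : Finset (Letter × Bool × grig × grig) := Finset.univ ×ˢ Finset.univ ×ˢ
    (Finset.range (⌊η * R⌋₊ + 1)).biUnion fun k => B (k + 1) ×ˢ B (η * R - k)
  have hmap : ∀ g ∈ B R, f g ∈ T := by
    intro g hg
    obtain ⟨w, -, -, h1, h2, h3⟩ := hf g ((finite_ball h0 hη R).mem_toFinset.1 hg)
    have p1 := weight_nonneg h0 hη (sectionWord false w)
    have p2 := weight_nonneg h0 hη (sectionWord true w)
    simp only [T, B, Finset.mem_product, Finset.mem_univ, true_and, Finset.mem_biUnion,
      Finset.mem_range, Set.Finite.mem_toFinset]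
    refine ⟨⌊weight η (sectionWord false w)⌋₊, ?_, ⟨_, h1.symm, (Nat.lt_floor_add_one _).le⟩,
      ⟨_, h2.symm, ?_⟩⟩
    · exact Nat.lt_succ_of_le (Nat.floor_le_floor (by linarith))
    · linarith [Nat.floor_le p1]
  have hinj : Set.InjOn f (B R) := by
    intro g hg g' hg' e
    obtain ⟨w, hg1, h1, h2, h3, -⟩ := hf g ((finite_ball h0 hη R).mem_toFinset.1 hg)
    obtain ⟨w', hg1', h1', h2', h3', -⟩ := hf g' ((finite_ball h0 hη R).mem_toFinset.1 hg')
    rw [e] at hg1 h1 h2 h3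
    have hw : wordElt w = wordElt w' := by
      refine wordElt_eq_of_sections (h1.symm.trans h1') fun x => ?_
      cases x
      · exact h2.symm.trans h2'
      · exact h3.symm.trans h3'
    exact hg1.trans (hw ▸ hg1'.symm)
  rw [hB]
  calc (B R).card ≤ T.card := Finset.card_le_card_of_injOn f hmap hinj
    _ ≤ 10 * ∑ k ∈ Finset.range (⌊η * R⌋₊ + 1), (B (k + 1) ×ˢ B (η * R - k)).card := by
      rw [Finset.card_product, Finset.card_product, ← mul_assoc]
      exact Nat.mul_le_mul (by decide) Finset.card_biUnion_le
    _ = _ := by simp only [Finset.card_product, hB]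

theorem rpow_add_rpow_le {α x y : ℝ} (h0 : 0 ≤ α) (h1 : α ≤ 1) (hx : 0 ≤ x) (hy : 0 ≤ y) :
    x ^ α + y ^ α ≤ 2 * ((x + y) / 2) ^ α := by
  have h := (Real.concaveOn_rpow h0 h1).2 hx hy (by norm_num : (0 : ℝ) ≤ 1 / 2)
    (by norm_num : (0 : ℝ) ≤ 1 / 2) (by norm_num)
  simp only [smul_eq_mul] at h
  rw [show (x + y) / 2 = 1 / 2 * x + 1 / 2 * y by ring]
  linarith

/-- After division by `S ^ α` the first term tends to `2 (η / 2)^α < 1`, and the logarithm is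
negligible. -/
theorem eventually_rpow_add_log_le {η α : ℝ} (h0 : 0 < η) (hα : 0 < α)
    (h : 2 * (η / 2) ^ α < 1) :
    ∀ᶠ S : ℝ in atTop, 2 * ((η * S + 3) / 2) ^ α + Real.log (10 * S) ≤ S ^ α := by
  obtain ⟨ρ, h1, h2⟩ := exists_between h
  have ht : Tendsto (fun S : ℝ => 2 * ((η + 3 * S⁻¹) / 2) ^ α) atTop
      (𝓝 (2 * ((η + 3 * 0) / 2) ^ α)) := by
    refine Tendsto.const_mul _ (Tendsto.rpow_const ?_ (Or.inr hα.le))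
    exact ((tendsto_inv_atTop_zero.const_mul 3).const_add η).div_const 2
  rw [mul_zero, add_zero] at ht
  have hl := (isLittleO_log_rpow_atTop hα).def (show 0 < (1 - ρ) / 2 by linarith)
  have hc : ∀ᶠ S : ℝ in atTop, Real.log 10 ≤ (1 - ρ) / 2 * S ^ α :=
    ((tendsto_rpow_atTop hα).const_mul_atTop (by linarith)).eventually_ge_atTop _
  filter_upwards [ht.eventually (gt_mem_nhds h1), hl, hc, eventually_ge_atTop 1]
    with S hS1 hS2 hS3 hS4
  have hS : 0 < S := by linarith
  have e : (η * S + 3) / 2 = (η + 3 * S⁻¹) / 2 * S := by field_simp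
  rw [Real.norm_of_nonneg (Real.log_nonneg hS4), Real.norm_of_nonneg (by positivity)] at hS2
  rw [e, Real.mul_rpow (by positivity) hS.le, Real.log_mul (by norm_num) hS.ne', ← mul_assoc]
  have := mul_le_mul_of_nonneg_right hS1.le (by positivity : 0 ≤ S ^ α)
  linarith

theorem exists_ncard_ball_le_exp {η α : ℝ} (h0 : 0 < η) (hη : η ^ 3 + η ^ 2 + η - 2 = 0)
    (hα : 0 < α) (hα1 : α ≤ 1) (h : 2 * (η / 2) ^ α < 1) :
    ∃ C : ℝ, 1 ≤ C ∧ ∀ R : ℝ, 0 ≤ R → ((ball η R).ncard : ℝ) ≤ Real.exp (C * (R + 1) ^ α) := by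
  have h1 := root_lt_one h0 hη
  obtain ⟨S, hS⟩ := eventually_atTop.1 (eventually_rpow_add_log_le h0 hα h)
  -- Beyond `R₀` the analytic inequality applies and `η R + 1 ≤ R - 1`, so all radii in the
  -- recursion drop by at least one and induction on an integer bound for `R` works. The constant
  -- `C` covers the radii up to `R₀`.
  let R₀ := max (max S 1) (2 / (1 - η))
  let C := max 1 (Real.log (ball η R₀).ncard)
  have hC : 1 ≤ C := le_max_left _ _
  have hR₀ : 1 ≤ R₀ := (le_max_right _ _).trans (le_max_left _ _)
  refine ⟨C, hC, ?_⟩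
  have key : ∀ n : ℕ, ∀ R : ℝ, 0 ≤ R → R ≤ n →
      ((ball η R).ncard : ℝ) ≤ Real.exp (C * (R + 1) ^ α) := by
    have hsmall : ∀ R : ℝ, 0 ≤ R → R ≤ R₀ →
        ((ball η R).ncard : ℝ) ≤ Real.exp (C * (R + 1) ^ α) := by
      intro R hR hR'
      have hcard : 0 < (ball η R₀).ncard :=
        (Set.ncard_pos (finite_ball h0 hη R₀)).2 ⟨1, one_mem_ball η (by linarith)⟩
      have hle : ((ball η R).ncard : ℝ) ≤ (ball η R₀).ncard := by
        exact_mod_cast Set.ncard_le_ncard (ball_mono η hR') (finite_ball h0 hη R₀)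
      refine hle.trans ?_
      rw [← Real.log_le_iff_le_exp (by exact_mod_cast hcard)]
      have h2 : 1 ≤ (R + 1) ^ α := Real.one_le_rpow (by linarith) hα.le
      have h3 : Real.log (ball η R₀).ncard ≤ C := le_max_right _ _
      nlinarith
    intro n
    induction n with
    | zero =>
      intro R hR hR'
      exact hsmall R hR (by push_cast at hR'; linarith)
    | succ n ih =>
      intro R hR hRn
      rcases le_or_gt R R₀ with hR' | hR'
      · exact hsmall R hR hR'
      have hRS : S ≤ R + 1 := by
        have : S ≤ R₀ := (le_max_left _ _).trans (le_max_left _ _)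
        linarith
      have hR2 : η * R + 1 ≤ R - 1 := by
        have : 2 / (1 - η) ≤ R := (le_max_right _ _).trans hR'.le
        rw [div_le_iff₀ (by linarith)] at this
        linarith
      push_cast at hRn
      have hηR : 0 ≤ η * R := by positivity
      have hfl : (⌊η * R⌋₊ : ℝ) ≤ η * R := Nat.floor_le hηR
      set E := Real.exp (C * (2 * ((η * (R + 1) + 3) / 2) ^ α)) with hE
      have hterm : ∀ k ∈ Finset.range (⌊η * R⌋₊ + 1),
          ((ball η (k + 1)).ncard * (ball η (η * R - k)).ncard : ℝ) ≤ E := by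
        intro k hk
        have hk : (k : ℝ) ≤ η * R := by
          refine le_trans ?_ hfl
          exact_mod_cast Nat.lt_succ_iff.1 (Finset.mem_range.1 hk)
        have hk0 : (0 : ℝ) ≤ k := Nat.cast_nonneg k
        refine (mul_le_mul (ih (k + 1) (by linarith) (by linarith))
          (ih (η * R - k) (by linarith) (by linarith)) (by positivity) (by positivity)).trans ?_
        rw [← Real.exp_add, hE, Real.exp_le_exp, ← mul_add]
        refine mul_le_mul_of_nonneg_left ?_ (by linarith)
        -- By concavity equal radii are the worst case; the two shifted radii add up to `η R + 3`.
        refine (rpow_add_rpow_le hα.le hα1 (by linarith) (by linarith)).trans ?_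
        refine mul_le_mul_of_nonneg_left ?_ (by norm_num)
        exact Real.rpow_le_rpow (by linarith) (by linarith) hα.le
      have hsum : ((ball η R).ncard : ℝ) ≤ 10 * ((⌊η * R⌋₊ + 1) * E) := by
        have h2 : ((ball η R).ncard : ℝ) ≤ 10 * ∑ k ∈ Finset.range (⌊η * R⌋₊ + 1),
            ((ball η (k + 1)).ncard * (ball η (η * R - k)).ncard : ℝ) := by
          exact_mod_cast ncard_ball_le h0 hη R
        refine h2.trans (mul_le_mul_of_nonneg_left ?_ (by norm_num))
        refine (Finset.sum_le_card_nsmul _ _ _ hterm).trans_eq ?_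
        simp
      have hE0 : 0 < E := Real.exp_pos _
      have h10 : 10 * ((⌊η * R⌋₊ + 1) * E) ≤ 10 * (R + 1) * E := by nlinarith
      refine hsum.trans (h10.trans ?_)
      have hlog := Real.log_nonneg (show (1 : ℝ) ≤ 10 * (R + 1) by linarith)
      rw [← Real.exp_log (show (0 : ℝ) < 10 * (R + 1) by linarith), hE, ← Real.exp_add,
        Real.exp_le_exp]
      -- Since `C ≥ 1`, the factor `10 (R + 1)` is absorbed as well.
      have := mul_le_mul_of_nonneg_left (hS (R + 1) hRS) (show 0 ≤ C by linarith)
      nlinarith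
  intro R hR
  exact key ⌈R⌉₊ R hR (Nat.le_ceil R)

theorem growthLE_exp_rpow {η α : ℝ} (h0 : 0 < η) (hη : η ^ 3 + η ^ 2 + η - 2 = 0)
    (hα : Real.log 2 / (Real.log 2 - Real.log η) < α) :
    GrowthLE (fun R => (growth R : ℝ)) (fun R => Real.exp (R ^ α)) := by
  have hl2 : 0 < Real.log 2 := Real.log_pos (by norm_num)
  have hlη : Real.log η < 0 := Real.log_neg h0 (root_lt_one h0 hη)
  have hd : 0 < Real.log 2 - Real.log η := by linarith
  -- An exponent at most `1` is needed for concavity; the threshold itself is below `1` because `η <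
  -- 1`.
  obtain ⟨β, hβ, hβ'⟩ : ∃ β, Real.log 2 / (Real.log 2 - Real.log η) < β ∧ β < min α 1 := by
    refine exists_between (lt_min hα ?_)
    rw [div_lt_one hd]; linarith
  have hβα : β ≤ α := hβ'.le.trans (min_le_left _ _)
  have hβ0 : 0 < β := (div_pos hl2 hd).trans hβ
  have h2 : 2 * (η / 2) ^ β < 1 := by
    rw [div_lt_iff₀ hd] at hβ
    rw [← Real.log_neg_iff (by positivity), Real.log_mul (by norm_num) (by positivity),
      Real.log_rpow (by positivity), Real.log_div h0.ne' (by norm_num)]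
    linarith
  obtain ⟨C, hC, hball⟩ := exists_ncard_ball_le_exp h0 hη hβ0 (hβ'.le.trans (min_le_right _ _)) h2
  -- The factor `C` in the exponent becomes the factor `C ^ β⁻¹` of the argument; the `2` absorbs `R
  -- + 1 ≤ 2 R`.
  have hD : 1 ≤ C ^ β⁻¹ := Real.one_le_rpow hC (by positivity)
  refine ⟨C ^ β⁻¹ * 2, by linarith, fun R hR => ?_⟩
  have hg : (growth R : ℝ) ≤ (ball η R).ncard := by exact_mod_cast growth_le_ncard_ball h0 hη R
  refine hg.trans ((hball R (by linarith)).trans (Real.exp_le_exp.2 ?_))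
  have hb : 1 ≤ C ^ β⁻¹ * 2 * R := by nlinarith
  calc C * (R + 1) ^ β ≤ C * (2 * R) ^ β :=
      mul_le_mul_of_nonneg_left (Real.rpow_le_rpow (by linarith) (by linarith) hβ0.le)
        (by linarith)
    _ = (C ^ β⁻¹ * 2 * R) ^ β := by
      rw [mul_assoc, Real.mul_rpow (x := C ^ β⁻¹) (by positivity) (by positivity),
        Real.rpow_inv_rpow (by linarith) hβ0.ne']
    _ ≤ _ := Real.rpow_le_rpow_of_exponent_le hb hβα

end Grigorchuk

/-! ### The number `η` -/

theorem exists_cubic_root : ∃ η : ℝ, 0.8105357 < η ∧ η < 0.8105358 ∧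
    η ^ 3 + η ^ 2 + η - 2 = 0 := by
  have hc : ContinuousOn (fun x : ℝ => x ^ 3 + x ^ 2 + x - 2) (Set.Icc 0.8105357 0.8105358) := by
    fun_prop
  obtain ⟨η, ⟨h1, h2⟩, h⟩ := intermediate_value_Ioo (by norm_num) hc
    (show (0 : ℝ) ∈ Set.Ioo _ _ by norm_num)
  exact ⟨η, h1, h2, h⟩

theorem cubic_root_unique {x y : ℝ} (hx : 0 < x) (hy : 0 < y) (h : x ^ 3 + x ^ 2 + x - 2 = 0)
    (h' : y ^ 3 + y ^ 2 + y - 2 = 0) : x = y := by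
  have hf : (x - y) * (x ^ 2 + x * y + y ^ 2 + x + y + 1) = 0 := by linear_combination h - h'
  rcases mul_eq_zero.1 hf with h | h
  · exact sub_eq_zero.1 h
  · exact absurd h (by positivity)

theorem abs_log_ratio_sub_lt {η : ℝ} (h1 : 0.8105357 < η) (h2 : η < 0.8105358) :
    |Real.log 2 / (Real.log 2 - Real.log η) - 0.76743| < 0.000005 := by
  -- Nine terms of the series of `log (1 - x)` at `x ≈ 0.19` leave an error of about `10^-7`.
  have hb1 := Real.abs_log_sub_add_sum_range_le (x := 1 - 0.8105357)
    (by rw [abs_of_pos] <;> norm_num) 9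
  have hb2 := Real.abs_log_sub_add_sum_range_le (x := 1 - 0.8105358)
    (by rw [abs_of_pos] <;> norm_num) 9
  rw [abs_of_pos (by norm_num : (0 : ℝ) < 1 - 0.8105357), abs_le] at hb1
  rw [abs_of_pos (by norm_num : (0 : ℝ) < 1 - 0.8105358), abs_le] at hb2
  have l1 : Real.log 0.8105357 < Real.log η := Real.log_lt_log (by norm_num) h1
  have l2 : Real.log η < Real.log 0.8105358 := Real.log_lt_log (by linarith) h2
  have e1 : (1 : ℝ) - (1 - 0.8105357) = 0.8105357 := by norm_num
  have e2 : (1 : ℝ) - (1 - 0.8105358) = 0.8105358 := by norm_num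
  rw [e1] at hb1
  rw [e2] at hb2
  norm_num [Finset.sum_range_succ] at hb1 hb2
  have l3 : -0.2100608 < Real.log η := by norm_num at l1 ⊢; linarith [hb1.1]
  have l4 : Real.log η < -0.2100590 := by norm_num at l2 ⊢; linarith [hb2.2]
  have g1 := Real.log_two_gt_d9
  have g2 := Real.log_two_lt_d9
  have hpos : 0 < Real.log 2 - Real.log η := by linarith
  rw [abs_lt, lt_sub_iff_add_lt, sub_lt_iff_lt_add, lt_div_iff₀ hpos, div_lt_iff₀ hpos]
  constructor <;> linarith

theorem mainTheorem2 :
    ∃ η : ℝ,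
      (0 < η ∧ η ^ 3 + η ^ 2 + η - 2 = 0) ∧
      (∀ x : ℝ, 0 < x → x ^ 3 + x ^ 2 + x - 2 = 0 → x = η) ∧
      |η - 0.81054| < 0.000005 ∧
      |Real.log 2 / (Real.log 2 - Real.log η) - 0.76743| < 0.000005 ∧
      (∀ w : List Grigorchuk.Gen, {n : ℕ | Grigorchuk.traverseCount (n + 2) w ≠ 0}.Finite) ∧
      (∃ P : Polynomial ℝ, ∀ (w : List Grigorchuk.Gen) (t : ℝ), 0 < t → t < η⁻¹ →
        0 < t⁻¹ + (t ^ 2)⁻¹ + (t ^ 3)⁻¹ - 2 ∧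
        Grigorchuk.traverseSeries w t ≤
          (w.length : ℝ) * ((P.eval t / t ^ 3) / (t⁻¹ + (t ^ 2)⁻¹ + (t ^ 3)⁻¹ - 2))) ∧
      (∀ α : ℝ, Real.log 2 / (Real.log 2 - Real.log η) < α →
        GrowthLE (fun R => (Grigorchuk.growth R : ℝ)) (fun R => Real.exp (R ^ α))) := by
  obtain ⟨η, h1, h2, hη⟩ := exists_cubic_root
  have h0 : 0 < η := lt_trans (by norm_num) h1
  refine ⟨η, ⟨h0, hη⟩, fun x hx h => cubic_root_unique hx h0 h hη, ?_,
    abs_log_ratio_sub_lt h1 h2, Grigorchuk.finite_traverseCount_ne_zero h0 hη,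
    Grigorchuk.exists_polynomial_traverseSeries_le h0 hη,
    fun α => Grigorchuk.growthLE_exp_rpow h0 hη⟩
  rw [abs_lt]
  constructor <;> linarith
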